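/- **Conventions.** Let $X$ be a topological space, $A\subset X$ a subset and $n\ge 0$ an integer. A *singular oriented $n$-manifold* in $(X,A)$ is a pair $(M,f)$ of a smooth compact oriented $n$-manifold $M$ with (possibly empty) boundary and a continuous map $f:(M,\partial M)\to(X,A)$. Write $-M$ for $M$ with the opposite orientation. Two singular oriented $n$-manifolds $(M_0,f_0)$, $(M_1,f_1)$ in $(X,A)$ are *bordant* if there are a compact oriented $(n+1)$-manifold $W$ with boundary and a continuous map $F:W\to X$ such that $\partial W=M_0\cup(-M_1)\cup M'$, where $M_0$ and $M_1$ are disjoint, $M_i\cap M'=\partial M_i$, $\partial M'=\partial M_0\sqcup\partial M_1$, $F|_{M_i}=f_i$ and $F(M')\subset A$. Here $W$ is smooth except that its boundary is allowed to have corners of codimension two along $\partial M_0\sqcup\partial M_1$. The classes $[M,\partial M,f]$ form an abelian group $\Omega_n(X,A)$, with addition induced by disjoint union. A continuous map of pairs $g:(X,A)\to(Y,B)$ induces the homomorphism $\Omega(g)[M,\partial M,f]=[M,\partial M,g\circ f]$. Dropping all orientations one obtains the unoriented bordism groups $\mathcal N_n(X,A)$. The *Čech bordism group* is the inverse limit $$\check\Omega_n(X,A)=\varprojlim_{U}\Omega_n(X,U)\subset\prod_U\Omega_n(X,U)$$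 over all open neighbourhoods $U$ of $A$ in $X$, with respect to the homomorphisms $\Omega_n(X,U)\to\Omega_n(X,V)$ induced by the inclusions for $U\subset V$. For a map of pairs $g:(X,A)\to(Y,B)$, the homomorphism $\check\Omega(g):\check\Omega_n(X,A)\to\check\Omega_n(Y,B)$ has as its component at an open neighbourhood $V$ of $B$ the projection to $\Omega_n(X,g^{-1}(V))$ followed by $\Omega(g):\Omega_n(X,g^{-1}(V))\to\Omega_n(Y,V)$. The groups $\check{\mathcal N}_n(X,A)$ and the homomorphisms $\check{\mathcal N}(g)$ are defined in the same way from $\mathcal N_n$. The *canonical homomorphism* $$j:\Omega_n(X,A)\to\check\Omega_n(X,A),\qquad [M,\partial M,f]\mapsto\big(i^U_*[M,\partial M,f]\big)_U,$$ is induced by the inclusions $i^U:(X,A)\to(X,U)$, and likewise $j:\mathcal N_n(X,A)\to\check{\mathcal N}_n(X,A)$. A topological space is a *Euclidean neighbourhood retract* (ENR) if it is homeomorphic to a subspace $Y$ of some $\mathbb R^m$ for which there are a neighbourhood $U$ of $Y$ in $\mathbb R^m$ and a retraction $U\to Y$. **Proposition.** If $X$ and $A\subset X$ are Euclidean neighbourhood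 retracts, then for every $n\ge0$ the canonical homomorphism $j:\Omega_n(X,A)\to\check\Omega_n(X,A)$ is an isomorphism of groups. Moreover $j$ is natural: for every continuous map $g:(X,A)\to(Y,B)$ of pairs of topological spaces, $j\circ\Omega(g)=\check\Omega(g)\circ j$. The same holds for unoriented bordism, that is, for $j:\mathcal N_n(X,A)\to\check{\mathcal N}_n(X,A)$. -/

import Mathlib

open Set Topology
open scoped Manifold ContDiff

noncomputable section

namespace RelBordism

/-! ### Smooth manifolds with boundary, in every dimension including zero -/

/-- The half space `{x ∈ ℝⁿ | x₀ ≥ 0}`; for `n = 0` there is no coordinate `x₀` and no condition,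
so that this is `ℝ⁰`. -/
def HalfSpace (n : ℕ) : Type :=
  {x : EuclideanSpace ℝ (Fin n) // ∀ i : Fin n, (i : ℕ) = 0 → 0 ≤ x i}

instance (n : ℕ) : TopologicalSpace (HalfSpace n) :=
  inferInstanceAs (TopologicalSpace
    {x : EuclideanSpace ℝ (Fin n) // ∀ i : Fin n, (i : ℕ) = 0 → 0 ≤ x i})

/-- The inclusion of the half space into `ℝⁿ`, with a retraction as its inverse. -/
def halfSpaceEquiv (n : ℕ) : PartialEquiv (HalfSpace n) (EuclideanSpace ℝ (Fin n)) where
  toFun := Subtype.val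
  invFun x := ⟨WithLp.toLp 2 fun i => if (i : ℕ) = 0 then max (x i) 0 else x i, by
    intro i hi
    simp [hi]⟩
  source := univ
  target := {x | ∀ i : Fin n, (i : ℕ) = 0 → 0 ≤ x i}
  map_source' x _ := x.2
  map_target' _ _ := mem_univ _
  left_inv' x _ := by
    apply Subtype.ext
    ext i
    by_cases hi : (i : ℕ) = 0
    · simp [hi, x.2 i hi]
    · simp [hi]
  right_inv' x hx := by
    ext i
    by_cases hi : (i : ℕ) = 0
    · simp [hi, hx i hi]
    · simp [hi]

/-- The model with corners of smooth `n`-manifolds with boundary. -/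
def bdryModel (n : ℕ) :
    ModelWithCorners ℝ (EuclideanSpace ℝ (Fin n)) (HalfSpace n) :=
  ModelWithCorners.ofConvexRange (halfSpaceEquiv n) rfl
    (by
      intro x hx y hy a b ha hb _ i hi
      have h1 := hx i hi
      have h2 := hy i hi
      simp only [PiLp.add_apply, PiLp.smul_apply, smul_eq_mul]
      positivity)
    continuous_subtype_val
    (by
      refine Continuous.subtype_mk ((PiLp.continuous_toLp 2 _).comp (continuous_pi fun i => ?_)) _
      by_cases hi : (i : ℕ) = 0
      · simp only [hi, if_true]
        fun_prop
      · simp only [hi, if_false]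
        fun_prop)
    (by
      have ho : IsOpen {x : EuclideanSpace ℝ (Fin n) | ∀ i : Fin n, 0 < x i} := by
        have : {x : EuclideanSpace ℝ (Fin n) | ∀ i : Fin n, 0 < x i}
            = ⋂ i, {x : EuclideanSpace ℝ (Fin n) | 0 < x i} := by
          ext x; simp
        rw [this]
        exact isOpen_iInter_of_finite fun i => isOpen_lt continuous_const (by fun_prop)
      refine ⟨WithLp.toLp 2 fun _ => 1, mem_interior.2 ⟨_, fun x hx i _ => (hx i).le, ho, ?_⟩⟩
      intro i
      simp)

/-- The model `HalfSpace n × [0, ∞)` of `(n+1)`-manifolds with boundary whose boundary may have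
corners of codimension two. -/
abbrev cornerModel (n : ℕ) :
    ModelWithCorners ℝ (EuclideanSpace ℝ (Fin n) × EuclideanSpace ℝ (Fin 1))
      (ModelProd (HalfSpace n) (EuclideanHalfSpace 1)) :=
  (bdryModel n).prod (𝓡∂ 1)

/-- The corner points of a manifold modelled on `HalfSpace n × [0, ∞)`: those at which both factors
of the chart lie on the boundary. -/
def cornerPoints (n : ℕ) (W : Type) [TopologicalSpace W]
    [ChartedSpace (ModelProd (HalfSpace n) (EuclideanHalfSpace 1)) W] : Set W :=
  {p | (extChartAt (cornerModel n) p p).1 ∈ frontier (range (bdryModel n)) ∧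
    (extChartAt (cornerModel n) p p).2 ∈ frontier (range (𝓡∂ 1))}

/-! ### Orientations -/

section Orientation

variable {E : Type} [NormedAddCommGroup E] [NormedSpace ℝ E]
  {H : Type} [TopologicalSpace H] {I : ModelWithCorners ℝ E H}
  {H' : Type} [TopologicalSpace H'] {I' : ModelWithCorners ℝ E H'}
  {M : Type} [TopologicalSpace M] [ChartedSpace H M]
  {N : Type} [TopologicalSpace N] [ChartedSpace H' N]

variable (I I') in
/-- The Jacobian determinant of `f : M → N` at `x`, where both tangent spaces are identified with
the model vector space `E` through the preferred charts at `x` and at `f x`. -/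
def jac (f : M → N) (x : M) : ℝ :=
  ContinuousLinearMap.det (M := E) (mfderiv I I' f x)

variable (I M) in
/-- An orientation of the manifold `M`: an orientation of every tangent space, varying continuously.
The orientation of `T_x M` is recorded by its sign relative to the fixed standard orientation of the
model vector space `E`, with which `T_x M` is identified through the preferred chart at `x`.
Continuity says that read in the chart at any `x₀` these orientations are constant near `x₀`.
For a manifold of dimension zero, this is a sign for every point. -/
structure TangentOrientation where
  sign : M → ℤˣ
  eventually_eq : ∀ x₀ : M, ∀ᶠ x in 𝓝 x₀,
    0 < ((sign x : ℤ) : ℝ) * ((sign x₀ : ℤ) : ℝ) * jac I 𝓘(ℝ, E) (extChartAt I x₀) x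

variable (I) in
/-- The vector `v` of `T_p M = E` points strictly out of `M`: in the preferred chart at `p`, moving
from `p` a little
in the direction `-v` leads into the interior. -/
def IsOutward (p : M) (v : E) : Prop :=
  ∃ s : ℝ, 0 < s ∧ extChartAt I p p - s • v ∈ interior (range I)

end Orientation

/-- The determinant of the frame `(v, A e₁, …, A eₙ)` of `ℝⁿ × ℝ` relative to the basis
`(f, e₁, …, eₙ)`, where `e₁, …, eₙ` is the standard basis of `ℝⁿ` and `f` that of `ℝ`, that is,
the determinant of the endomorphism `f ↦ v`, `eᵢ ↦ A eᵢ`. -/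
def frameDet {n : ℕ}
    (A : EuclideanSpace ℝ (Fin n) →L[ℝ] EuclideanSpace ℝ (Fin n) × EuclideanSpace ℝ (Fin 1))
    (v : EuclideanSpace ℝ (Fin n) × EuclideanSpace ℝ (Fin 1)) : ℝ :=
  LinearMap.det ((A.coprod ((EuclideanSpace.proj (0 : Fin 1)).smulRight v) :
    EuclideanSpace ℝ (Fin n) × EuclideanSpace ℝ (Fin 1) →L[ℝ]
      EuclideanSpace ℝ (Fin n) × EuclideanSpace ℝ (Fin 1)) :
    EuclideanSpace ℝ (Fin n) × EuclideanSpace ℝ (Fin 1) →ₗ[ℝ]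
      EuclideanSpace ℝ (Fin n) × EuclideanSpace ℝ (Fin 1))


section OrientationLemmas

variable {E : Type} [NormedAddCommGroup E] [NormedSpace ℝ E]
  {H : Type} [TopologicalSpace H] {I : ModelWithCorners ℝ E H}
  {H' : Type} [TopologicalSpace H'] {I' : ModelWithCorners ℝ E H'}
  {H'' : Type} [TopologicalSpace H''] {I'' : ModelWithCorners ℝ E H''}
  {M : Type} [TopologicalSpace M] [ChartedSpace H M]
  {M' : Type} [TopologicalSpace M'] [ChartedSpace H M']
  {N : Type} [TopologicalSpace N] [ChartedSpace H' N]
  {Q : Type} [TopologicalSpace Q] [ChartedSpace H'' Q]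

lemma jac_comp {g : N → Q} {f : M → N} {x : M}
    (hg : MDifferentiableAt I' I'' g (f x)) (hf : MDifferentiableAt I I' f x) :
    jac I I'' (g ∘ f) x = jac I' I'' g (f x) * jac I I' f x := by
  unfold jac
  rw [mfderiv_comp x hg hf]
  exact LinearMap.det_comp (M := E) _ _

lemma jac_id (x : M) : jac I I (id : M → M) x = 1 := by
  unfold jac
  rw [mfderiv_id]
  exact LinearMap.det_id (M := E)

lemma jac_inl (x : M) : jac I I (Sum.inl : M → M ⊕ M') x = 1 := by
  unfold jac
  rw [(hasMFDerivAt_inl (p := Sum.inl x)).mfderiv]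
  exact LinearMap.det_id (M := E)

lemma jac_inr (x : M') : jac I I (Sum.inr : M' → M ⊕ M') x = 1 := by
  unfold jac
  rw [(hasMFDerivAt_inr (p := Sum.inr x)).mfderiv]
  exact LinearMap.det_id (M := E)

lemma mdiff_inl (x : M) : MDifferentiableAt I I (Sum.inl : M → M ⊕ M') x :=
  (hasMFDerivAt_inl (p := Sum.inl x)).mdifferentiableAt

lemma mdiff_inr (x : M') : MDifferentiableAt I I (Sum.inr : M' → M ⊕ M') x :=
  (hasMFDerivAt_inr (p := Sum.inr x)).mdifferentiableAt

lemma jac_at_inl {g : M ⊕ M' → N} {x : M} (hg : MDifferentiableAt I I' g (Sum.inl x)) :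
    jac I I' g (Sum.inl x) = jac I I' (g ∘ Sum.inl) x := by
  rw [jac_comp hg (mdiff_inl x), jac_inl, mul_one]

lemma jac_at_inr {g : M ⊕ M' → N} {x : M'} (hg : MDifferentiableAt I I' g (Sum.inr x)) :
    jac I I' g (Sum.inr x) = jac I I' (g ∘ Sum.inr) x := by
  rw [jac_comp hg (mdiff_inr x), jac_inr, mul_one]

lemma jac_extChartAt_self [IsManifold I ∞ M] (x : M) :
    jac I 𝓘(ℝ, E) (extChartAt I x) x = 1 := by
  have : mfderiv I 𝓘(ℝ, E) (extChartAt I x) x = ContinuousLinearMap.id ℝ E := by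
    rw [(hasMFDerivAt_extChartAt (mem_chart_source H x)).mfderiv]
    refine (mfderiv_chartAt_eq_tangentCoordChange (mem_chart_source H x)).trans ?_
    ext v
    exact tangentCoordChange_self (mem_extChartAt_source x)
  unfold jac
  rw [this]
  exact LinearMap.det_id (M := E)

lemma sign_mul_self (u : ℤˣ) : ((u : ℤ) : ℝ) * ((u : ℤ) : ℝ) = 1 := by
  rcases Int.units_eq_one_or u with h | h <;> simp [h]

namespace TangentOrientation

/-- The opposite orientation. -/
def neg (o : TangentOrientation I M) : TangentOrientation I M where
  sign x := -o.sign x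
  eventually_eq x₀ := by
    filter_upwards [o.eventually_eq x₀] with x hx
    simpa using hx

/-- The orientation of a disjoint union. -/
def sum [IsManifold I ∞ M] [IsManifold I ∞ M'] (o : TangentOrientation I M)
    (o' : TangentOrientation I M') : TangentOrientation I (M ⊕ M') where
  sign := Sum.elim o.sign o'.sign
  eventually_eq := by
    rintro (x₀ | x₀)
    · rw [nhds_inl, Filter.eventually_map]
      filter_upwards [o.eventually_eq x₀, (chartAt H x₀).open_source.mem_nhds
        (mem_chart_source H x₀)] with x hx hxs
      rw [jac_at_inl (mdifferentiableAt_extChartAt ?_)]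
      · have : extChartAt I (Sum.inl x₀ : M ⊕ M') ∘ Sum.inl = extChartAt I x₀ := by
          funext y
          exact extChartAt_inl_apply
        rw [this]
        exact hx
      · rw [ChartedSpace.sum_chartAt_inl]
        exact ⟨x, hxs, rfl⟩
    · rw [nhds_inr, Filter.eventually_map]
      filter_upwards [o'.eventually_eq x₀, (chartAt H x₀).open_source.mem_nhds
        (mem_chart_source H x₀)] with x hx hxs
      rw [jac_at_inr (mdifferentiableAt_extChartAt ?_)]
      · have : extChartAt I (Sum.inr x₀ : M ⊕ M') ∘ Sum.inr = extChartAt I x₀ := by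
          funext y
          exact extChartAt_inr_apply
        rw [this]
        exact hx
      · rw [ChartedSpace.sum_chartAt_inr]
        exact ⟨x, hxs, rfl⟩

/-- The orientation of the empty manifold. -/
def empty [IsEmpty M] : TangentOrientation I M where
  sign x := (IsEmpty.false x).elim
  eventually_eq x := (IsEmpty.false x).elim

end TangentOrientation

end OrientationLemmas

/-- The standard orientation of `[0, 1]`: the preferred chart reverses it at the end point `1`. -/
def iccOrientation : TangentOrientation (𝓡∂ 1) (Icc (0 : ℝ) 1) where
  sign t := if (t : ℝ) < 1 then 1 else -1
  eventually_eq t₀ := by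
    by_cases h₀ : (t₀ : ℝ) < 1
    · filter_upwards [(isOpen_lt continuous_subtype_val continuous_const).mem_nhds h₀] with t ht
      have ht' : (t : ℝ) < 1 := ht
      have : extChartAt (𝓡∂ 1) t₀ = extChartAt (𝓡∂ 1) t := by
        simp only [extChartAt, Icc_chartedSpaceChartAt, h₀, ht', if_true]
      rw [this, jac_extChartAt_self]
      simp [h₀, ht']
    · have h1 : (t₀ : ℝ) = 1 := le_antisymm t₀.2.2 (not_lt.1 h₀)
      have hpos : (0 : ℝ) < t₀ := by rw [h1]; exact one_pos
      filter_upwards [(isOpen_lt continuous_const continuous_subtype_val).mem_nhds hpos] with t ht0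
      have ht0' : 0 < (t : ℝ) := ht0
      by_cases ht : (t : ℝ) < 1
      · have hsrc : t ∈ (chartAt (EuclideanHalfSpace 1) t₀).source := by
          simp only [Icc_chartedSpaceChartAt, h₀, if_false]
          exact ht0'
        have key : mfderiv (𝓡∂ 1) 𝓘(ℝ, EuclideanSpace ℝ (Fin 1)) (extChartAt (𝓡∂ 1) t₀) t =
            -ContinuousLinearMap.id ℝ (EuclideanSpace ℝ (Fin 1)) := by
          rw [(hasMFDerivAt_extChartAt hsrc).mfderiv]
          refine (mfderiv_chartAt_eq_tangentCoordChange hsrc).trans ?_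
          rw [tangentCoordChange_def]
          have hlt : (extChartAt (𝓡∂ 1) t t) 0 < 1 := by
            simp [extChartAt, Icc_chartedSpaceChartAt, ht, IccLeftChart_apply,
              modelWithCornersEuclideanHalfSpace_toFun]
          have hd : HasFDerivWithinAt
              (fun z : EuclideanSpace ℝ (Fin 1) => WithLp.toLp 2 (fun _ => (1 : ℝ)) - z)
              (-ContinuousLinearMap.id ℝ (EuclideanSpace ℝ (Fin 1))) (range (𝓡∂ 1))
              (extChartAt (𝓡∂ 1) t t) :=
            (hasFDerivWithinAt_id _ _).const_sub _
          have hf : ∀ z ∈ range (𝓡∂ 1), z 0 < 1 →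
              (extChartAt (𝓡∂ 1) t₀ ∘ (extChartAt (𝓡∂ 1) t).symm) z =
                WithLp.toLp 2 (fun _ => (1 : ℝ)) - z := by
            rintro _ ⟨z, rfl⟩ hz
            have hz' : z.1 0 ≤ 1 := hz.le
            have hs : (𝓡∂ 1).symm z.1 = z := (𝓡∂ 1).left_inv z
            ext i
            rw [Subsingleton.elim i 0]
            simp [extChartAt, Icc_chartedSpaceChartAt, ht, h₀, IccRightChart_apply,
              modelWithCornersEuclideanHalfSpace_toFun, IccLeftChart_symm_apply, hs, hz']
          refine (hd.congr_of_eventuallyEq ?_ (hf _ (mem_range_self _) hlt)).fderivWithin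
            ((𝓡∂ 1).uniqueDiffOn _ (mem_range_self _))
          have hev : ∀ᶠ z : EuclideanSpace ℝ (Fin 1) in 𝓝[range (𝓡∂ 1)] (extChartAt (𝓡∂ 1) t t),
              z 0 < 1 :=
            mem_nhdsWithin_of_mem_nhds ((isOpen_lt (by fun_prop) continuous_const).mem_nhds hlt)
          filter_upwards [self_mem_nhdsWithin, hev] with z hz hz1 using hf z hz hz1
        have hdet : ContinuousLinearMap.det
            (-ContinuousLinearMap.id ℝ (EuclideanSpace ℝ (Fin 1))) = -1 := by
          have : ((-ContinuousLinearMap.id ℝ (EuclideanSpace ℝ (Fin 1)) :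
              EuclideanSpace ℝ (Fin 1) →L[ℝ] EuclideanSpace ℝ (Fin 1)) :
              EuclideanSpace ℝ (Fin 1) →ₗ[ℝ] EuclideanSpace ℝ (Fin 1)) =
              (-1 : ℝ) • LinearMap.id := by
            ext v
            simp
          rw [ContinuousLinearMap.det, this, LinearMap.det_smul]
          simp
        have hjac : jac (𝓡∂ 1) 𝓘(ℝ, EuclideanSpace ℝ (Fin 1)) (extChartAt (𝓡∂ 1) t₀) t = -1 := by
          unfold jac
          rw [key]
          exact hdet
        rw [hjac]
        simp [h₀, ht]
      · have : t = t₀ := Subtype.ext (by rw [h1]; exact le_antisymm t.2.2 (not_lt.1 ht))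
        rw [this, jac_extChartAt_self]
        simp [h₀]

/-- The product orientation of `M × [0, 1]`. -/
def prodOrientation {E : Type} [NormedAddCommGroup E] [NormedSpace ℝ E] [FiniteDimensional ℝ E]
    {H : Type} [TopologicalSpace H] {I : ModelWithCorners ℝ E H}
    {M : Type} [TopologicalSpace M] [ChartedSpace H M] [IsManifold I ∞ M]
    (o : TangentOrientation I M) :
    TangentOrientation (I.prod (𝓡∂ 1)) (M × Icc (0 : ℝ) 1) where
  sign p := o.sign p.1 * iccOrientation.sign p.2
  eventually_eq := by
    rintro ⟨x₀, t₀⟩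
    rw [nhds_prod_eq]
    filter_upwards [((o.eventually_eq x₀).and ((chartAt H x₀).open_source.mem_nhds
        (mem_chart_source H x₀))).prod_mk ((iccOrientation.eventually_eq t₀).and
        ((chartAt (EuclideanHalfSpace 1) t₀).open_source.mem_nhds
        (mem_chart_source _ t₀)))]
    rintro ⟨x, t⟩ ⟨⟨hx, hxs⟩, ⟨ht, hts⟩⟩
    have key : jac (I.prod (𝓡∂ 1)) 𝓘(ℝ, E × EuclideanSpace ℝ (Fin 1))
        (extChartAt (I.prod (𝓡∂ 1)) (x₀, t₀)) (x, t) =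
        jac I 𝓘(ℝ, E) (extChartAt I x₀) x *
          jac (𝓡∂ 1) 𝓘(ℝ, EuclideanSpace ℝ (Fin 1)) (extChartAt (𝓡∂ 1) t₀) t := by
      unfold jac
      rw [extChartAt_prod, modelWithCornersSelf_prod, ← chartedSpaceSelf_prod]
      have := mfderiv_prodMap (p := (x, t)) (mdifferentiableAt_extChartAt (I := I) hxs)
        (mdifferentiableAt_extChartAt (I := 𝓡∂ 1) hts)
      refine (congrArg _ this).trans ?_
      exact LinearMap.det_prodMap _ _
    rw [key]
    have := mul_pos hx ht
    push_cast
    calc _ < _ := this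
      _ = _ := by ring

/-! ### Singular manifolds and bordisms -/

/-- The two versions of the theory. -/
inductive Kind
  | oriented
  | unoriented

universe u v w

variable {K : Kind} {n : ℕ} {X : Type u} [TopologicalSpace X] {A : Set X}

variable (K n A) in
/-- A singular `n`-manifold in the pair `(X, A)`: a compact smooth `n`-manifold `M` with boundary,
oriented if `K = oriented`, with a continuous map `f : (M, ∂M) → (X, A)`. -/
structure RelSingularManifold where
  M : Type
  [top : TopologicalSpace M]
  [charted : ChartedSpace (HalfSpace n) M]
  [isManifold : IsManifold (bdryModel n) ∞ M]
  [compact : CompactSpace M]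
  [t2 : T2Space M]
  orientation : K = .oriented → TangentOrientation (bdryModel n) M
  f : M → X
  continuous_f : Continuous f
  mapsTo_boundary : MapsTo f ((bdryModel n).boundary M) A

namespace RelSingularManifold

attribute [instance] top charted isManifold compact t2

/-- The same manifold with another map, possibly into another pair. -/
def withMap {Y : Type v} [TopologicalSpace Y] {B : Set Y} (P : RelSingularManifold K n A)
    (g : P.M → Y) (hg : Continuous g) (hB : MapsTo g ((bdryModel n).boundary P.M) B) :
    RelSingularManifold K n B where
  M := P.M
  orientation := P.orientation
  f := g
  continuous_f := hg
  mapsTo_boundary := hB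

/-- The image `(M, g ∘ f)` of `(M, f)` under a map of pairs `g`. -/
def map {Y : Type v} [TopologicalSpace Y] {B : Set Y} (g : C(X, Y)) (hg : MapsTo g A B)
    (P : RelSingularManifold K n A) : RelSingularManifold K n B :=
  P.withMap (g ∘ P.f) (g.continuous.comp P.continuous_f) (hg.comp P.mapsTo_boundary)

/-- The disjoint union. -/
def sum (P Q : RelSingularManifold K n A) : RelSingularManifold K n A where
  M := P.M ⊕ Q.M
  orientation h := (P.orientation h).sum (Q.orientation h)
  f := Sum.elim P.f Q.f
  continuous_f := P.continuous_f.sumElim Q.continuous_f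
  mapsTo_boundary := by
    rw [ModelWithCorners.boundary_disjointUnion]
    rintro _ (⟨x, hx, rfl⟩ | ⟨x, hx, rfl⟩)
    · exact P.mapsTo_boundary hx
    · exact Q.mapsTo_boundary hx

/-- The same singular manifold with the opposite orientation. -/
def neg (P : RelSingularManifold K n A) : RelSingularManifold K n A where
  M := P.M
  orientation h := (P.orientation h).neg
  f := P.f
  continuous_f := P.continuous_f
  mapsTo_boundary := P.mapsTo_boundary

variable (K n A) in
/-- The empty singular manifold. -/
def empty : RelSingularManifold K n A :=
  letI : ChartedSpace (HalfSpace n) Empty := ChartedSpace.empty _ _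
  { M := Empty
    orientation := fun _ => TangentOrientation.empty
    f := fun x => x.elim
    continuous_f := continuous_of_discreteTopology
    mapsTo_boundary := fun x => x.elim }

end RelSingularManifold

/-- A null bordism of the singular manifold `P = (M, f)` in `(X, A)`: a compact smooth
`(n+1)`-manifold `W` with boundary, oriented if `K = oriented`, with a continuous map `F : W → X`
such that `∂W` is the union of `M` and of another part, `side`, with `M ∩ side = ∂M`, and such that
`F` is `f` on `M` and maps `side` to `A`. Here `M` is smoothly embedded in `∂W` by `φ`, and its
orientation is that induced by `W` (outward vector first).
The boundary of `W` is smooth except that it may have corners of codimension two along `∂M`, where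
`M` and `side` meet; so the cylinder `M × [0, 1]` needs no modification when `∂M ≠ ∅`.
Since `M` and `side` are complementary in `∂W` and meet in `∂M`, `side` is an `n`-manifold with
boundary `∂M`. -/
structure NullBordism (P : RelSingularManifold K n A) where
  W : Type
  [top : TopologicalSpace W]
  [charted : ChartedSpace (ModelProd (HalfSpace n) (EuclideanHalfSpace 1)) W]
  [isManifold : IsManifold (cornerModel n) ∞ W]
  [compact : CompactSpace W]
  [t2 : T2Space W]
  orientation : K = .oriented → TangentOrientation (cornerModel n) W
  F : W → X
  continuous_F : Continuous F
  /-- the embedding of `M` -/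
  φ : P.M → W
  smooth_φ : ContMDiff (bdryModel n) (cornerModel n) ∞ φ
  injective_φ : Function.Injective φ
  immersion_φ : ∀ x, Function.Injective (mfderiv (bdryModel n) (cornerModel n) φ x)
  /-- the remaining part of the boundary -/
  side : Set W
  isClosed_side : IsClosed side
  boundary_eq : (cornerModel n).boundary W = range φ ∪ side
  inter_eq : range φ ∩ side = φ '' (bdryModel n).boundary P.M
  cornerPoints_subset : cornerPoints n W ⊆ φ '' (bdryModel n).boundary P.M
  F_φ : ∀ x, F (φ x) = P.f x
  F_side : MapsTo F side A
  orientation_φ : ∀ (h : K = .oriented) (x : P.M)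
    (v : EuclideanSpace ℝ (Fin n) × EuclideanSpace ℝ (Fin 1)), IsOutward (cornerModel n) (φ x) v →
    0 < (((P.orientation h).sign x : ℤ) : ℝ) * (((orientation h).sign (φ x) : ℤ) : ℝ) *
      frameDet (mfderiv (bdryModel n) (cornerModel n) φ x) v

attribute [instance] NullBordism.top NullBordism.charted NullBordism.isManifold NullBordism.compact NullBordism.t2


section BoundaryLemmas

variable {E E' : Type} [NormedAddCommGroup E] [NormedSpace ℝ E]
  [NormedAddCommGroup E'] [NormedSpace ℝ E']
  {H : Type} [TopologicalSpace H] {I : ModelWithCorners ℝ E H}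
  {H' : Type} [TopologicalSpace H'] {J : ModelWithCorners ℝ E' H'}
  {M : Type} [TopologicalSpace M] [ChartedSpace H M]
  {M' : Type} [TopologicalSpace M'] [ChartedSpace H M']
  {N : Type} [TopologicalSpace N] [ChartedSpace H' N]
  {N' : Type} [TopologicalSpace N'] [ChartedSpace H' N']

lemma mfderiv_at_inl {g : M ⊕ M' → N} {x : M} (hg : MDifferentiableAt I J g (Sum.inl x)) :
    @Eq (E →L[ℝ] E') (mfderiv I J g (Sum.inl x)) (mfderiv I J (g ∘ Sum.inl) x) := by
  rw [mfderiv_comp x hg (mdiff_inl x), (hasMFDerivAt_inl (p := Sum.inl x)).mfderiv]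
  rfl

lemma mfderiv_at_inr {g : M ⊕ M' → N} {x : M'} (hg : MDifferentiableAt I J g (Sum.inr x)) :
    @Eq (E →L[ℝ] E') (mfderiv I J g (Sum.inr x)) (mfderiv I J (g ∘ Sum.inr) x) := by
  rw [mfderiv_comp x hg (mdiff_inr x), (hasMFDerivAt_inr (p := Sum.inr x)).mfderiv]
  rfl

lemma mfderiv_inl_comp {f : M → N} {x : M} (hf : MDifferentiableAt I J f x) :
    @Eq (E →L[ℝ] E') (mfderiv I J (Sum.inl ∘ f : M → N ⊕ N') x) (mfderiv I J f x) := by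
  rw [mfderiv_comp x (mdiff_inl (f x)) hf, (hasMFDerivAt_inl (p := Sum.inl (f x))).mfderiv]
  rfl

lemma mfderiv_inr_comp {f : M → N'} {x : M} (hf : MDifferentiableAt I J f x) :
    @Eq (E →L[ℝ] E') (mfderiv I J (Sum.inr ∘ f : M → N ⊕ N') x) (mfderiv I J f x) := by
  rw [mfderiv_comp x (mdiff_inr (f x)) hf, (hasMFDerivAt_inr (p := Sum.inr (f x))).mfderiv]
  rfl

lemma isOutward_inl {p : M} {v : E} :
    IsOutward I (Sum.inl p : M ⊕ M') v ↔ IsOutward I p v := by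
  unfold IsOutward
  rw [extChartAt_inl_apply]

lemma isOutward_inr {p : M'} {v : E} :
    IsOutward I (Sum.inr p : M ⊕ M') v ↔ IsOutward I p v := by
  unfold IsOutward
  rw [extChartAt_inr_apply]

lemma frameDet_comp {n : ℕ}
    (A : EuclideanSpace ℝ (Fin n) →L[ℝ] EuclideanSpace ℝ (Fin n) × EuclideanSpace ℝ (Fin 1))
    (B : EuclideanSpace ℝ (Fin n) →L[ℝ] EuclideanSpace ℝ (Fin n))
    (v : EuclideanSpace ℝ (Fin n) × EuclideanSpace ℝ (Fin 1)) :
    frameDet (A.comp B) v = frameDet A v * B.det := by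
  have h1 : ((B : EuclideanSpace ℝ (Fin n) →ₗ[ℝ] EuclideanSpace ℝ (Fin n)).prodMap
      (LinearMap.id : EuclideanSpace ℝ (Fin 1) →ₗ[ℝ] EuclideanSpace ℝ (Fin 1))).det = B.det := by
    rw [LinearMap.det_prodMap, LinearMap.det_id, mul_one]
  rw [← h1]
  unfold frameDet
  rw [← LinearMap.det_comp]
  congr 1

lemma frameDet_inl {n : ℕ}
    (v : EuclideanSpace ℝ (Fin n) × EuclideanSpace ℝ (Fin 1)) :
    frameDet (ContinuousLinearMap.inl ℝ _ _) v = v.2 0 := by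
  unfold frameDet
  rw [← LinearMap.det_toMatrix ((EuclideanSpace.basisFun (Fin n) ℝ).toBasis.prod
    (EuclideanSpace.basisFun (Fin 1) ℝ).toBasis)]
  have : LinearMap.toMatrix ((EuclideanSpace.basisFun (Fin n) ℝ).toBasis.prod
      (EuclideanSpace.basisFun (Fin 1) ℝ).toBasis) ((EuclideanSpace.basisFun (Fin n) ℝ).toBasis.prod
      (EuclideanSpace.basisFun (Fin 1) ℝ).toBasis)
      (((ContinuousLinearMap.inl ℝ _ _).coprod ((EuclideanSpace.proj (0 : Fin 1)).smulRight v) :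
      EuclideanSpace ℝ (Fin n) × EuclideanSpace ℝ (Fin 1) →L[ℝ]
        EuclideanSpace ℝ (Fin n) × EuclideanSpace ℝ (Fin 1)) :
      EuclideanSpace ℝ (Fin n) × EuclideanSpace ℝ (Fin 1) →ₗ[ℝ]
        EuclideanSpace ℝ (Fin n) × EuclideanSpace ℝ (Fin 1)) =
      Matrix.fromBlocks 1 (Matrix.of fun i _ => v.1 i) 0 (Matrix.of fun i _ => v.2 i) := by
    ext (i | i) (j | j)
    · simp [LinearMap.toMatrix_apply, Matrix.one_apply]
    · simp [LinearMap.toMatrix_apply, Subsingleton.elim j 0]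
    · simp [LinearMap.toMatrix_apply]
    · simp [LinearMap.toMatrix_apply, Subsingleton.elim j 0]
  rw [this, Matrix.det_fromBlocks_zero₂₁]
  simp

lemma mdiff_of_smooth {f : M → N} (hf : ContMDiff I J ∞ f) (x : M) : MDifferentiableAt I J f x :=
  (hf x).mdifferentiableAt (by simp)

lemma mfderiv_sumMap_inl {f : M → N} {g : M' → N'} (hf : ContMDiff I J ∞ f)
    (hg : ContMDiff I J ∞ g) (x : M) :
    @Eq (E →L[ℝ] E') (mfderiv I J (Sum.map f g) (Sum.inl x)) (mfderiv I J f x) :=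
  (mfderiv_at_inl (mdiff_of_smooth (hf.sumMap hg) _)).trans (mfderiv_inl_comp (mdiff_of_smooth hf x))

lemma mfderiv_sumMap_inr {f : M → N} {g : M' → N'} (hf : ContMDiff I J ∞ f)
    (hg : ContMDiff I J ∞ g) (x : M') :
    @Eq (E →L[ℝ] E') (mfderiv I J (Sum.map f g) (Sum.inr x)) (mfderiv I J g x) :=
  (mfderiv_at_inr (mdiff_of_smooth (hf.sumMap hg) _)).trans (mfderiv_inr_comp (mdiff_of_smooth hg x))

lemma range_sum {α β γ δ : Type} (f : α → γ) (g : β → δ) :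
    range (Sum.map f g) = Sum.inl '' range f ∪ Sum.inr '' range g := by
  ext (y | y) <;> simp [Sum.exists]

lemma sum_boundary (P Q : RelSingularManifold K n A) :
    (bdryModel n).boundary (P.sum Q).M =
      Sum.inl '' (bdryModel n).boundary P.M ∪ Sum.inr '' (bdryModel n).boundary Q.M :=
  ModelWithCorners.boundary_disjointUnion

end BoundaryLemmas

/-- An isomorphism of singular manifolds: an orientation preserving diffeomorphism over `X`. -/
structure Iso (P Q : RelSingularManifold K n A) where
  e : P.M ≃ₘ^∞⟮bdryModel n, bdryModel n⟯ Q.M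
  f_e : ∀ x, Q.f (e x) = P.f x
  orientation_e : ∀ (h : K = .oriented) (x : P.M),
    0 < (((P.orientation h).sign x : ℤ) : ℝ) * (((Q.orientation h).sign (e x) : ℤ) : ℝ) *
      jac (bdryModel n) (bdryModel n) e x

namespace Iso

variable {P Q R S : RelSingularManifold K n A}

lemma mdiff (i : Iso P Q) (x : P.M) : MDifferentiableAt (bdryModel n) (bdryModel n) i.e x :=
  mdiff_of_smooth i.e.contMDiff x

/-- Composition. -/
def trans (i : Iso P Q) (j : Iso Q R) : Iso P R where
  e := i.e.trans j.e
  f_e x := (j.f_e _).trans (i.f_e x)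
  orientation_e h x := by
    have h1 := mul_pos (i.orientation_e h x) (j.orientation_e h (i.e x))
    have h2 := sign_mul_self ((Q.orientation h).sign (i.e x))
    have h3 : jac (bdryModel n) (bdryModel n) (i.e.trans j.e) x =
      jac (bdryModel n) (bdryModel n) j.e (i.e x) * jac (bdryModel n) (bdryModel n) i.e x :=
      jac_comp (j.mdiff _) (i.mdiff x)
    rw [h3]
    calc _ < _ := h1
      _ = _ := by
        change _ = (((P.orientation h).sign x : ℤ) : ℝ) *
          (((R.orientation h).sign (j.e (i.e x)) : ℤ) : ℝ) * _
        linear_combination (((P.orientation h).sign x : ℤ) : ℝ) *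
          (((R.orientation h).sign (j.e (i.e x)) : ℤ) : ℝ) *
          jac (bdryModel n) (bdryModel n) j.e (i.e x) * jac (bdryModel n) (bdryModel n) i.e x * h2

/-- The identity. -/
def refl (P : RelSingularManifold K n A) : Iso P P where
  e := Diffeomorph.refl _ _ _
  f_e _ := rfl
  orientation_e h x := by
    have : jac (bdryModel n) (bdryModel n) (Diffeomorph.refl (bdryModel n) P.M ∞) x = 1 := jac_id x
    rw [this, mul_one]
    exact (sign_mul_self _).symm ▸ one_pos

/-- An isomorphism from signs that agree. -/
lemma orientation_of_eq {a b : ℤˣ} {c : ℝ} (h : a = b) (hc : c = 1) :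
    0 < ((a : ℤ) : ℝ) * ((b : ℤ) : ℝ) * c := by
  rw [h, hc, mul_one, sign_mul_self]
  exact one_pos

lemma jac_elim_inl {M₁ M₂ N : Type} [TopologicalSpace M₁] [TopologicalSpace M₂]
    [TopologicalSpace N] [ChartedSpace (HalfSpace n) M₁] [ChartedSpace (HalfSpace n) M₂]
    [ChartedSpace (HalfSpace n) N] {g : M₁ ⊕ M₂ → N}
    (hg : ContMDiff (bdryModel n) (bdryModel n) ∞ g) (x : M₁) :
    jac (bdryModel n) (bdryModel n) g (Sum.inl x) =
      jac (bdryModel n) (bdryModel n) (g ∘ Sum.inl) x :=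
  jac_at_inl (mdiff_of_smooth hg _)

lemma jac_elim_inr {M₁ M₂ N : Type} [TopologicalSpace M₁] [TopologicalSpace M₂]
    [TopologicalSpace N] [ChartedSpace (HalfSpace n) M₁] [ChartedSpace (HalfSpace n) M₂]
    [ChartedSpace (HalfSpace n) N] {g : M₁ ⊕ M₂ → N}
    (hg : ContMDiff (bdryModel n) (bdryModel n) ∞ g) (x : M₂) :
    jac (bdryModel n) (bdryModel n) g (Sum.inr x) =
      jac (bdryModel n) (bdryModel n) (g ∘ Sum.inr) x :=
  jac_at_inr (mdiff_of_smooth hg _)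

/-- The disjoint union of isomorphisms. -/
def sumCongr (i : Iso P Q) (j : Iso R S) : Iso (P.sum R) (Q.sum S) where
  e := Diffeomorph.sumCongr i.e j.e
  f_e := by
    rintro (x | x)
    · exact i.f_e x
    · exact j.f_e x
  orientation_e := by
    have hs := (Diffeomorph.sumCongr i.e j.e).contMDiff
    rintro h (x | x)
    · have h1 : jac (bdryModel n) (bdryModel n) (Diffeomorph.sumCongr i.e j.e) (Sum.inl x) =
          jac (bdryModel n) (bdryModel n) i.e x := by
        refine (jac_elim_inl hs x).trans ?_
        exact (jac_comp (mdiff_inl _) (i.mdiff x)).trans (by rw [jac_inl, one_mul])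
      exact h1.symm ▸ i.orientation_e h x
    · have h1 : jac (bdryModel n) (bdryModel n) (Diffeomorph.sumCongr i.e j.e) (Sum.inr x) =
          jac (bdryModel n) (bdryModel n) j.e x := by
        refine (jac_elim_inr hs x).trans ?_
        exact (jac_comp (mdiff_inr _) (j.mdiff x)).trans (by rw [jac_inr, one_mul])
      exact h1.symm ▸ j.orientation_e h x

/-- `P ⊔ Q ≅ Q ⊔ P`. -/
def sumComm (P Q : RelSingularManifold K n A) : Iso (P.sum Q) (Q.sum P) where
  e := Diffeomorph.sumComm _ _ _ _
  f_e := by rintro (x | x) <;> rfl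
  orientation_e := by
    have hs := (Diffeomorph.sumComm (bdryModel n) P.M ∞ Q.M).contMDiff
    rintro h (x | x)
    · exact orientation_of_eq rfl ((jac_elim_inl hs x).trans (jac_inr x))
    · exact orientation_of_eq rfl ((jac_elim_inr hs x).trans (jac_inl x))

/-- `(P ⊔ Q) ⊔ R ≅ P ⊔ (Q ⊔ R)`. -/
def sumAssoc (P Q R : RelSingularManifold K n A) :
    Iso ((P.sum Q).sum R) (P.sum (Q.sum R)) where
  e := Diffeomorph.sumAssoc _ _ _ _ _
  f_e := by rintro ((x | x) | x) <;> rfl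
  orientation_e := by
    have hs := (Diffeomorph.sumAssoc (bdryModel n) P.M ∞ Q.M R.M).contMDiff
    rintro h ((x | x) | x)
    · refine orientation_of_eq rfl ((jac_elim_inl hs (Sum.inl x)).trans ?_)
      exact (jac_elim_inl (hs.comp ContMDiff.inl) x).trans (jac_inl x)
    · refine orientation_of_eq rfl ((jac_elim_inl hs (Sum.inr x)).trans ?_)
      refine (jac_elim_inr (hs.comp ContMDiff.inl) x).trans ?_
      exact (jac_comp (mdiff_inr _) (mdiff_inl x)).trans (by rw [jac_inl, jac_inr, one_mul])
    · refine orientation_of_eq rfl ((jac_elim_inr hs x).trans ?_)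
      exact (jac_comp (mdiff_inr _) (mdiff_inr x)).trans (by rw [jac_inr, jac_inr, one_mul])

/-- The inverse of an isomorphism. -/
def symm (i : Iso P Q) : Iso Q P where
  e := i.e.symm
  f_e y := by
    rw [← i.f_e, Diffeomorph.apply_symm_apply]
  orientation_e h y := by
    obtain ⟨x, rfl⟩ := i.e.surjective y
    have h1 := i.orientation_e h x
    have h2 : jac (bdryModel n) (bdryModel n) i.e.symm (i.e x) *
        jac (bdryModel n) (bdryModel n) i.e x = 1 := by
      rw [← jac_comp (mdiff_of_smooth i.e.symm.contMDiff _) (i.mdiff x)]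
      have : i.e.symm ∘ i.e = id := funext i.e.symm_apply_apply
      rw [this, jac_id]
    change 0 < (((Q.orientation h).sign (i.e x) : ℤ) : ℝ) *
      (((P.orientation h).sign (i.e.symm (i.e x)) : ℤ) : ℝ) *
      jac (bdryModel n) (bdryModel n) i.e.symm (i.e x)
    rw [Diffeomorph.symm_apply_apply]
    have h3 : 0 < jac (bdryModel n) (bdryModel n) i.e.symm (i.e x) ^ 2 := by
      have : jac (bdryModel n) (bdryModel n) i.e.symm (i.e x) ≠ 0 := left_ne_zero_of_mul_eq_one h2
      positivity
    refine (mul_pos h1 h3).trans_eq ?_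
    linear_combination (((P.orientation h).sign x : ℤ) : ℝ) *
      (((Q.orientation h).sign (i.e x) : ℤ) : ℝ) *
      jac (bdryModel n) (bdryModel n) i.e.symm (i.e x) * h2

/-- `P ⊔ ∅ ≅ P`. -/
def sumEmpty (P : RelSingularManifold K n A) : Iso (P.sum (RelSingularManifold.empty K n A)) P where
  e := haveI : IsEmpty (RelSingularManifold.empty K n A).M := inferInstanceAs (IsEmpty Empty)
    Diffeomorph.sumEmpty _ _ _
  f_e := by
    rintro (x | x)
    · rfl
    · exact Empty.elim x
  orientation_e := by
    have : IsEmpty (RelSingularManifold.empty K n A).M := inferInstanceAs (IsEmpty Empty)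
    have hs := (Diffeomorph.sumEmpty (bdryModel n) P.M
      (M' := (RelSingularManifold.empty K n A).M) ∞).contMDiff
    rintro h (x | x)
    · exact orientation_of_eq rfl ((jac_elim_inl hs x).trans (jac_id x))
    · exact Empty.elim x

/-- `-(P ⊔ Q) ≅ -P ⊔ -Q`. -/
def negSum (P Q : RelSingularManifold K n A) : Iso (P.neg.sum Q.neg) (P.sum Q).neg where
  e := Diffeomorph.refl _ _ _
  f_e _ := rfl
  orientation_e h x := by
    have : jac (bdryModel n) (bdryModel n)
        (Diffeomorph.refl (bdryModel n) (P.sum Q).M ∞) x = 1 := jac_id x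
    refine orientation_of_eq ?_ this
    rcases x with x | x <;> rfl

/-- `(P ⊔ Q) ⊔ (R ⊔ S) ≅ (P ⊔ R) ⊔ (Q ⊔ S)`. -/
def sumSumSumComm (P Q R S : RelSingularManifold K n A) :
    Iso ((P.sum Q).sum (R.sum S)) ((P.sum R).sum (Q.sum S)) :=
  (sumAssoc P Q (R.sum S)).trans <|
    ((refl P).sumCongr <| (sumAssoc Q R S).symm.trans <|
      ((sumComm Q R).sumCongr (refl S)).trans (sumAssoc R Q S)).trans
    (sumAssoc P R (Q.sum S)).symm

end Iso

namespace NullBordism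

/-- The disjoint union of two null bordisms. -/
def sum {P Q : RelSingularManifold K n A} (V : NullBordism P) (V' : NullBordism Q) :
    NullBordism (P.sum Q) where
  W := V.W ⊕ V'.W
  orientation h := (V.orientation h).sum (V'.orientation h)
  F := Sum.elim V.F V'.F
  continuous_F := V.continuous_F.sumElim V'.continuous_F
  φ := Sum.map V.φ V'.φ
  smooth_φ := V.smooth_φ.sumMap V'.smooth_φ
  injective_φ := Sum.map_injective.2 ⟨V.injective_φ, V'.injective_φ⟩
  immersion_φ := by
    rintro (x | x)
    · intro a b hab
      have h := mfderiv_sumMap_inl V.smooth_φ V'.smooth_φ x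
      exact V.immersion_φ x (((DFunLike.congr_fun h a).symm.trans hab).trans
        (DFunLike.congr_fun h b))
    · intro a b hab
      have h := mfderiv_sumMap_inr V.smooth_φ V'.smooth_φ x
      exact V'.immersion_φ x (((DFunLike.congr_fun h a).symm.trans hab).trans
        (DFunLike.congr_fun h b))
  side := Sum.inl '' V.side ∪ Sum.inr '' V'.side
  isClosed_side := (Topology.IsClosedEmbedding.inl.isClosedMap _ V.isClosed_side).union
    (Topology.IsClosedEmbedding.inr.isClosedMap _ V'.isClosed_side)
  boundary_eq := by
    rw [ModelWithCorners.boundary_disjointUnion, V.boundary_eq, V'.boundary_eq]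
    refine Eq.trans ?_ (congrArg (· ∪ _) (range_sum V.φ V'.φ).symm)
    ext (y | y) <;> simp
  inter_eq := by
    have h1 := Set.ext_iff.1 V.inter_eq
    have h2 := Set.ext_iff.1 V'.inter_eq
    rw [sum_boundary]
    refine (congrArg (· ∩ _) (range_sum V.φ V'.φ)).trans ?_
    refine Eq.trans ?_ (image_union (Sum.map V.φ V'.φ) _ _).symm
    refine Eq.trans ?_ (congrArg₂ (· ∪ ·) (image_image (Sum.map V.φ V'.φ) Sum.inl _).symm
      (image_image (Sum.map V.φ V'.φ) Sum.inr _).symm)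
    ext (y | y)
    · simpa using h1 y
    · simpa using h2 y
  cornerPoints_subset := by
    rintro (y | y) hy
    · obtain ⟨x, hx, rfl⟩ := V.cornerPoints_subset (show y ∈ cornerPoints n V.W by
        simpa only [cornerPoints, mem_ofPred_eq, extChartAt_inl_apply] using hy)
      exact ⟨Sum.inl x, ModelWithCorners.boundaryPoint_inl x hx, rfl⟩
    · obtain ⟨x, hx, rfl⟩ := V'.cornerPoints_subset (show y ∈ cornerPoints n V'.W by
        simpa only [cornerPoints, mem_ofPred_eq, extChartAt_inr_apply] using hy)
      exact ⟨Sum.inr x, ModelWithCorners.boundaryPoint_inr x hx, rfl⟩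
  F_φ := by
    rintro (x | x)
    · exact V.F_φ x
    · exact V'.F_φ x
  F_side := by
    rintro _ (⟨x, hx, rfl⟩ | ⟨x, hx, rfl⟩)
    · exact V.F_side hx
    · exact V'.F_side hx
  orientation_φ := by
    rintro h (x | x) v hv
    · have := V.orientation_φ h x v (isOutward_inl.1 hv)
      rw [← mfderiv_sumMap_inl V.smooth_φ V'.smooth_φ x] at this
      exact this
    · have := V'.orientation_φ h x v (isOutward_inr.1 hv)
      rw [← mfderiv_sumMap_inr V.smooth_φ V'.smooth_φ x] at this
      exact this

/-- The same null bordism with the opposite orientation. -/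
def neg {P : RelSingularManifold K n A} (V : NullBordism P) : NullBordism P.neg where
  W := V.W
  orientation h := (V.orientation h).neg
  F := V.F
  continuous_F := V.continuous_F
  φ := V.φ
  smooth_φ := V.smooth_φ
  injective_φ := V.injective_φ
  immersion_φ := V.immersion_φ
  side := V.side
  isClosed_side := V.isClosed_side
  boundary_eq := V.boundary_eq
  inter_eq := V.inter_eq
  cornerPoints_subset := V.cornerPoints_subset
  F_φ := V.F_φ
  F_side := V.F_side
  orientation_φ h x v hv := by
    refine (V.orientation_φ h x v hv).trans_eq ?_
    change _ = (((-(P.orientation h).sign x : ℤˣ) : ℤ) : ℝ) *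
      (((-(V.orientation h).sign (V.φ x) : ℤˣ) : ℤ) : ℝ) *
      frameDet (mfderiv (bdryModel n) (cornerModel n) V.φ x) v
    push_cast
    ring

/-- Transport of a null bordism along an isomorphism. -/
def ofIso {P Q : RelSingularManifold K n A} (i : Iso P Q) (V : NullBordism Q) : NullBordism P where
  W := V.W
  orientation := V.orientation
  F := V.F
  continuous_F := V.continuous_F
  φ := V.φ ∘ i.e
  smooth_φ := V.smooth_φ.comp i.e.contMDiff
  injective_φ := V.injective_φ.comp i.e.injective
  immersion_φ x := by
    rw [mfderiv_comp x (mdiff_of_smooth V.smooth_φ _) (i.mdiff x)]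
    exact (V.immersion_φ _).comp (i.e.mfderivToContinuousLinearEquiv (by simp) x).injective
  side := V.side
  isClosed_side := V.isClosed_side
  boundary_eq := by
    rw [V.boundary_eq, EquivLike.range_comp V.φ i.e]
  inter_eq := by
    rw [EquivLike.range_comp V.φ i.e, V.inter_eq, image_comp, i.e.image_boundary (by simp)]
  cornerPoints_subset := by
    rw [image_comp, i.e.image_boundary (by simp)]
    exact V.cornerPoints_subset
  F_φ x := (V.F_φ _).trans (i.f_e x)
  F_side := V.F_side
  orientation_φ h x v hv := by
    have h1 := mul_pos (i.orientation_e h x) (V.orientation_φ h (i.e x) v hv)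
    have h2 := sign_mul_self ((Q.orientation h).sign (i.e x))
    have h3 : frameDet (mfderiv (bdryModel n) (cornerModel n) (V.φ ∘ i.e) x) v =
        frameDet (mfderiv (bdryModel n) (cornerModel n) V.φ (i.e x)) v *
          jac (bdryModel n) (bdryModel n) i.e x := by
      rw [mfderiv_comp x (mdiff_of_smooth V.smooth_φ _) (i.mdiff x)]
      exact frameDet_comp _ _ _
    rw [h3]
    calc _ < _ := h1
      _ = _ := by
        simp only [Function.comp_apply]
        linear_combination (((P.orientation h).sign x : ℤ) : ℝ) *
          (((V.orientation h).sign (V.φ (i.e x)) : ℤ) : ℝ) *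
          jac (bdryModel n) (bdryModel n) i.e x *
          frameDet (mfderiv (bdryModel n) (cornerModel n) V.φ (i.e x)) v * h2

section Ends

/-- The inclusion of the two ends of the cylinder. -/
def ends (M : Type) : M ⊕ M → M × Icc (0 : ℝ) 1 :=
  Sum.elim (fun x => (x, 0)) (fun x => (x, 1))

lemma range_ends (M : Type) : range (ends M) = univ ×ˢ {⊥, ⊤} := by
  ext ⟨x, t⟩
  constructor
  · rintro ⟨y | y, h⟩
    · exact ⟨trivial, Or.inl (Prod.ext_iff.1 h).2.symm⟩
    · exact ⟨trivial, Or.inr (Prod.ext_iff.1 h).2.symm⟩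
  · rintro ⟨-, h | h⟩
    · exact ⟨Sum.inl x, Prod.ext rfl h.symm⟩
    · exact ⟨Sum.inr x, Prod.ext rfl h.symm⟩

variable (n) (M : Type) [TopologicalSpace M] [ChartedSpace (HalfSpace n) M]

lemma contMDiff_ends : ContMDiff (bdryModel n) (cornerModel n) ∞ (ends M) :=
  (contMDiff_id.prodMk contMDiff_const).sumElim (contMDiff_id.prodMk contMDiff_const)

lemma mfderiv_end_inl (x : M) :
    @Eq (EuclideanSpace ℝ (Fin n) →L[ℝ] EuclideanSpace ℝ (Fin n) × EuclideanSpace ℝ (Fin 1))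
      (mfderiv (bdryModel n) (cornerModel n) (ends M) (Sum.inl x))
      (ContinuousLinearMap.inl ℝ _ _) :=
  (mfderiv_at_inl (mdiff_of_smooth (contMDiff_ends n M) _)).trans mfderiv_prod_left

lemma mfderiv_end_inr (x : M) :
    @Eq (EuclideanSpace ℝ (Fin n) →L[ℝ] EuclideanSpace ℝ (Fin n) × EuclideanSpace ℝ (Fin 1))
      (mfderiv (bdryModel n) (cornerModel n) (ends M) (Sum.inr x))
      (ContinuousLinearMap.inl ℝ _ _) :=
  (mfderiv_at_inr (mdiff_of_smooth (contMDiff_ends n M) _)).trans mfderiv_prod_left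

variable {n M} in
lemma outward_end (x : M) (t : Icc (0 : ℝ) 1) (ht : t ∈ (𝓡∂ 1).boundary (Icc (0 : ℝ) 1))
    (v : EuclideanSpace ℝ (Fin n) × EuclideanSpace ℝ (Fin 1))
    (hv : IsOutward (cornerModel n) (x, t) v) : v.2 0 < 0 := by
  obtain ⟨s, hs, h⟩ := hv
  have ht' : (0 : ℝ) = extChartAt (𝓡∂ 1) t t 0 := by
    have : extChartAt (𝓡∂ 1) t t ∈ frontier (range (𝓡∂ 1)) := ht
    rwa [frontier_range_modelWithCornersEuclideanHalfSpace] at this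
  rw [modelWithCorners_prod_coe, range_prodMap, interior_prod_eq] at h
  have h2 := h.2
  rw [interior_range_modelWithCornersEuclideanHalfSpace] at h2
  have h3 : 0 < extChartAt (𝓡∂ 1) t t 0 - s * v.2 0 := h2
  rw [← ht', zero_sub] at h3
  nlinarith

end Ends

/-- The cylinder over `P` with a homotopy: it shows that homotopic maps of pairs are bordant. -/
def cylinder (P : RelSingularManifold K n A) (G : P.M × Icc (0 : ℝ) 1 → X) (hG : Continuous G)
    (hA : ∀ p : P.M × Icc (0 : ℝ) 1, p.1 ∈ (bdryModel n).boundary P.M → G p ∈ A) :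
    NullBordism ((P.withMap (fun x => G (x, 0)) (by fun_prop) (fun x hx => hA _ hx)).sum
      (P.withMap (fun x => G (x, 1)) (by fun_prop) (fun x hx => hA _ hx)).neg) where
  W := P.M × Icc (0 : ℝ) 1
  orientation h := (prodOrientation (P.orientation h)).neg
  F := G
  continuous_F := hG
  φ := ends P.M
  smooth_φ := contMDiff_ends n P.M
  injective_φ := by
    rintro (x | x) (y | y) h
    · exact congrArg Sum.inl (Prod.ext_iff.1 h).1
    · exact absurd (Prod.ext_iff.1 h).2 zero_ne_one
    · exact absurd (Prod.ext_iff.1 h).2 one_ne_zero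
    · exact congrArg Sum.inr (Prod.ext_iff.1 h).1
  immersion_φ := by
    rintro (x | x)
    · intro a b hab
      have h := mfderiv_end_inl n P.M x
      exact (Prod.ext_iff.1 (((DFunLike.congr_fun h a).symm.trans hab).trans
        (DFunLike.congr_fun h b))).1
    · intro a b hab
      have h := mfderiv_end_inr n P.M x
      exact (Prod.ext_iff.1 (((DFunLike.congr_fun h a).symm.trans hab).trans
        (DFunLike.congr_fun h b))).1
  side := (bdryModel n).boundary P.M ×ˢ univ
  isClosed_side := ((bdryModel n).isClosed_boundary (n := ∞) (by simp)).prod isClosed_univ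
  boundary_eq := by
    rw [ModelWithCorners.boundary_prod, boundary_Icc]
    refine congrArg (· ∪ _) ?_
    refine Eq.trans ?_ (range_ends P.M).symm
    rfl
  inter_eq := by
    rw [sum_boundary]
    refine (congrArg (· ∩ _) (range_ends P.M)).trans ?_
    refine Eq.trans ?_ (image_union (ends P.M) _ _).symm
    refine Eq.trans ?_ (congrArg₂ (· ∪ ·) (image_image (ends P.M) Sum.inl _).symm
      (image_image (ends P.M) Sum.inr _).symm)
    ext ⟨x, t⟩
    constructor
    · rintro ⟨⟨-, rfl | rfl⟩, hx, -⟩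
      · exact Or.inl ⟨x, hx, rfl⟩
      · exact Or.inr ⟨x, hx, rfl⟩
    · rintro (⟨y, hy, h⟩ | ⟨y, hy, h⟩)
      · obtain ⟨rfl, rfl⟩ := Prod.ext_iff.1 h
        exact ⟨⟨trivial, Or.inl rfl⟩, hy, trivial⟩
      · obtain ⟨rfl, rfl⟩ := Prod.ext_iff.1 h
        exact ⟨⟨trivial, Or.inr rfl⟩, hy, trivial⟩
  cornerPoints_subset := by
    rintro ⟨x, t⟩ ⟨hx, ht⟩
    rw [sum_boundary]
    have ht' : t ∈ (𝓡∂ 1).boundary (Icc (0 : ℝ) 1) := ht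
    rw [boundary_Icc] at ht'
    rcases ht' with rfl | rfl
    · exact ⟨Sum.inl x, Or.inl ⟨x, hx, rfl⟩, rfl⟩
    · exact ⟨Sum.inr x, Or.inr ⟨x, hx, rfl⟩, rfl⟩
  F_φ := by
    rintro (x | x) <;> rfl
  F_side p hp := hA p hp.1
  orientation_φ := by
    rintro h (x | x) v hv
    · have hd := congrArg (frameDet · v) (mfderiv_end_inl n P.M x)
      simp only [frameDet_inl] at hd
      have hv' := outward_end x 0 (by rw [boundary_Icc]; exact Or.inl rfl) v hv
      have hs := sign_mul_self ((P.orientation h).sign x)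
      have h0 : iccOrientation.sign (0 : Icc (0 : ℝ) 1) = 1 := by simp [iccOrientation]
      change 0 < (((P.orientation h).sign x : ℤ) : ℝ) *
        (((-((P.orientation h).sign x * iccOrientation.sign (0 : Icc (0 : ℝ) 1)) : ℤˣ) : ℤ) : ℝ) *
        frameDet (mfderiv (bdryModel n) (cornerModel n) (ends P.M) (Sum.inl x)) v
      rw [hd, h0]
      push_cast
      nlinarith
    · have hd := congrArg (frameDet · v) (mfderiv_end_inr n P.M x)
      simp only [frameDet_inl] at hd
      have hv' := outward_end x 1 (by rw [boundary_Icc]; exact Or.inr rfl) v hv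
      have hs := sign_mul_self ((P.orientation h).sign x)
      have h0 : iccOrientation.sign (1 : Icc (0 : ℝ) 1) = -1 := by simp [iccOrientation]
      change 0 < (((-(P.orientation h).sign x : ℤˣ) : ℤ) : ℝ) *
        (((-((P.orientation h).sign x * iccOrientation.sign (1 : Icc (0 : ℝ) 1)) : ℤˣ) : ℤ) : ℝ) *
        frameDet (mfderiv (bdryModel n) (cornerModel n) (ends P.M) (Sum.inr x)) v
      rw [hd, h0]
      push_cast
      nlinarith

end NullBordism

/-! ### Bordism groups -/

/-- A bordism between `P` and `Q` is a null bordism of `P ⊔ -Q`: its boundary is the union of `P`,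
of `-Q` and of a part lying over `A`. -/
abbrev Bordism (P Q : RelSingularManifold K n A) : Type _ := NullBordism (P.sum Q.neg)

/-- `P` and `Q` are bordant in `(X, A)`. -/
def Bordant (P Q : RelSingularManifold K n A) : Prop := Nonempty (Bordism P Q)

namespace Bordant

variable {P Q R S : RelSingularManifold K n A}

lemma of_null {T : RelSingularManifold K n A} (V : NullBordism T) (i : Iso (P.sum Q.neg) T) :
    Bordant P Q :=
  ⟨V.ofIso i⟩

lemma self (P : RelSingularManifold K n A) : Bordant P P :=
  ⟨NullBordism.cylinder P (fun p => P.f p.1) (P.continuous_f.comp continuous_fst)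
    (fun _ hp => P.mapsTo_boundary hp)⟩

lemma of_iso (i : Iso P Q) : Bordant P Q := by
  obtain ⟨V⟩ := self Q
  exact of_null V (i.sumCongr (Iso.refl _))

lemma add (h : Bordant P Q) (h' : Bordant R S) : Bordant (P.sum R) (Q.sum S) := by
  obtain ⟨V⟩ := h
  obtain ⟨V'⟩ := h'
  exact of_null (V.sum V') (((Iso.refl _).sumCongr (Iso.negSum Q S).symm).trans
    (Iso.sumSumSumComm P R Q.neg S.neg))

lemma neg (h : Bordant P Q) : Bordant P.neg Q.neg := by
  obtain ⟨V⟩ := h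
  exact of_null V.neg (Iso.negSum P Q.neg)

lemma neg_sum_self (P : RelSingularManifold K n A) :
    Bordant (P.neg.sum P) (RelSingularManifold.empty K n A) := by
  obtain ⟨V⟩ := self P
  have i : Iso (RelSingularManifold.empty K n A).neg (RelSingularManifold.empty K n A) :=
    { e := Diffeomorph.refl _ _ _
      f_e := fun _ => rfl
      orientation_e := fun _ x => Empty.elim x }
  exact of_null V ((((Iso.refl _).sumCongr i).trans (Iso.sumEmpty _)).trans (Iso.sumComm _ _))

/-- The image of a bordism under a map of pairs. -/
lemma map {Y : Type v} [TopologicalSpace Y] {B : Set Y} (g : C(X, Y)) (hg : MapsTo g A B)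
    (h : Bordant P Q) : Bordant (P.map g hg) (Q.map g hg) := by
  obtain ⟨V⟩ := h
  exact ⟨{
    W := V.W
    orientation := V.orientation
    F := g ∘ V.F
    continuous_F := g.continuous.comp V.continuous_F
    φ := V.φ
    smooth_φ := V.smooth_φ
    injective_φ := V.injective_φ
    immersion_φ := V.immersion_φ
    side := V.side
    isClosed_side := V.isClosed_side
    boundary_eq := V.boundary_eq
    inter_eq := V.inter_eq
    cornerPoints_subset := V.cornerPoints_subset
    F_φ := by
      rintro (x | x)
      · exact congrArg g (V.F_φ (Sum.inl x))
      · exact congrArg g (V.F_φ (Sum.inr x))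
    F_side := hg.comp V.F_side
    orientation_φ := V.orientation_φ }⟩

end Bordant

variable (K n A) in
/-- The relative bordism group of the pair `(X, A)` in dimension `n`: the quotient of the set of
singular manifolds by the equivalence relation generated by "bordant" (which is an equivalence
relation itself). It is `Ωₙ(X, A)` for `K = oriented` and `𝒩ₙ(X, A)` for `K = unoriented`. -/
def BordismGroup : Type (max 1 u) := Quot (Bordant (K := K) (n := n) (A := A))

namespace BordismGroup

/-- The bordism class `[M, ∂M; f]`. -/
def mk (P : RelSingularManifold K n A) : BordismGroup K n A := Quot.mk _ P

/-- Addition is induced by the disjoint union. -/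
instance : Add (BordismGroup K n A) where
  add := Quot.map₂ RelSingularManifold.sum (fun P _ _ h => (Bordant.self P).add h)
    (fun _ _ P h => h.add (Bordant.self P))

/-- The zero element is the class of the empty manifold. -/
instance : Zero (BordismGroup K n A) where
  zero := mk (RelSingularManifold.empty K n A)

/-- Negation is induced by the reversal of orientations. -/
instance : Neg (BordismGroup K n A) where
  neg := Quot.map RelSingularManifold.neg (fun _ _ h => h.neg)

instance : AddCommGroup (BordismGroup K n A) where
  __ := AddGroup.ofLeftAxioms (G := BordismGroup K n A)
    (by
      rintro ⟨P⟩ ⟨Q⟩ ⟨R⟩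
      exact Quot.sound (Bordant.of_iso (Iso.sumAssoc P Q R)))
    (by
      rintro ⟨P⟩
      exact Quot.sound (Bordant.of_iso ((Iso.sumComm _ P).trans (Iso.sumEmpty P))))
    (by
      rintro ⟨P⟩
      exact Quot.sound (Bordant.neg_sum_self P))
  add_comm := by
    rintro ⟨P⟩ ⟨Q⟩
    exact Quot.sound (Bordant.of_iso (Iso.sumComm P Q))

variable {Y : Type v} [TopologicalSpace Y] {B : Set Y} {Z : Type w} [TopologicalSpace Z] {C : Set Z}

/-- The homomorphism `[M, ∂M; f] ↦ [M, ∂M; g ∘ f]` induced by a map of pairs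
`g : (X, A) → (Y, B)`. -/
def map (g : C(X, Y)) (hg : MapsTo g A B) : BordismGroup K n A →+ BordismGroup K n B :=
  AddMonoidHom.mk' (Quot.map (RelSingularManifold.map g hg) fun _ _ h => h.map g hg) (by
    rintro ⟨P⟩ ⟨Q⟩
    refine Quot.sound (Bordant.of_iso
      { e := Diffeomorph.refl _ _ _
        f_e := by rintro (x | x) <;> rfl
        orientation_e := ?_ })
    intro h x
    exact Iso.orientation_of_eq rfl
      (jac_id (I := bdryModel n) (M := (P.sum Q).M) x))

lemma map_mk (g : C(X, Y)) (hg : MapsTo g A B) (P : RelSingularManifold K n A) :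
    map g hg (mk P) = mk (P.map g hg) := rfl

lemma map_id (x : BordismGroup K n A) : map (.id X) (mapsTo_id A) x = x := by
  obtain ⟨P⟩ := x
  rfl

lemma map_map (g : C(X, Y)) (hg : MapsTo g A B) (g' : C(Y, Z)) (hg' : MapsTo g' B C)
    (x : BordismGroup K n A) :
    map g' hg' (map g hg x) = map (g'.comp g) (hg'.comp hg) x := by
  obtain ⟨P⟩ := x
  rfl

end BordismGroup

/-! ### Čech bordism -/

/-- The open neighbourhoods of `A` in `X`. -/
abbrev OpenNhd (A : Set X) : Type u := {U : Set X // IsOpen U ∧ A ⊆ U}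

/-- The homomorphism induced by the inclusion `(X, A) → (X, U)` for `A ⊆ U`. -/
def incl {A U : Set X} (h : A ⊆ U) : BordismGroup K n A →+ BordismGroup K n U :=
  BordismGroup.map (.id X) fun _ ha => h ha

variable (K n A) in
/-- The Čech bordism group of `(X, A)`: the inverse limit of the groups of `(X, U)` over the open
neighbourhoods `U` of `A`, as the group of compatible families. -/
def CechBordismGroup : AddSubgroup (∀ U : OpenNhd A, BordismGroup K n U.1) where
  carrier := {x | ∀ (U V : OpenNhd A) (h : U.1 ⊆ V.1), incl h (x U) = x V}
  zero_mem' U V h := map_zero _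
  add_mem' hx hy U V h := by
    rw [Pi.add_apply, map_add, hx, hy, Pi.add_apply]
  neg_mem' hx U V h := by
    rw [Pi.neg_apply, map_neg, hx, Pi.neg_apply]

namespace CechBordismGroup

variable {Y : Type v} [TopologicalSpace Y] {B : Set Y} {Z : Type w} [TopologicalSpace Z] {C : Set Z}

/-- The preimage of an open neighbourhood under a map of pairs. -/
def preimage (g : C(X, Y)) (hg : MapsTo g A B) (V : OpenNhd B) : OpenNhd A :=
  ⟨g ⁻¹' V.1, V.2.1.preimage g.continuous, fun _ ha => V.2.2 (hg ha)⟩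

/-- The homomorphism induced by a map of pairs `g : (X, A) → (Y, B)`: its component at `V` is
the composite of the projection to `U = g⁻¹(V)` with the map induced by `g : (X, U) → (Y, V)`. -/
def map (g : C(X, Y)) (hg : MapsTo g A B) :
    CechBordismGroup K n A →+ CechBordismGroup K n B where
  toFun x := ⟨fun V => BordismGroup.map g (mapsTo_preimage g V.1) (x.1 (preimage g hg V)), by
    intro U V h
    beta_reduce
    rw [← x.2 (preimage g hg U) (preimage g hg V) (preimage_mono h)]
    refine (BordismGroup.map_map _ _ _ _ _).trans ?_
    exact (BordismGroup.map_map (.id X) (fun _ ha => preimage_mono h ha) g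
      (mapsTo_preimage g V.1) (x.1 (preimage g hg U))).symm⟩
  map_zero' := Subtype.ext (funext fun _ => map_zero _)
  map_add' _ _ := Subtype.ext (funext fun _ => map_add _ _ _)

lemma map_id (x : CechBordismGroup K n A) : map (.id X) (mapsTo_id A) x = x :=
  Subtype.ext (funext fun _ => BordismGroup.map_id _)

lemma map_map (g : C(X, Y)) (hg : MapsTo g A B) (g' : C(Y, Z)) (hg' : MapsTo g' B C)
    (x : CechBordismGroup K n A) :
    map g' hg' (map g hg x) = map (g'.comp g) (hg'.comp hg) x :=
  Subtype.ext (funext fun _ => BordismGroup.map_map _ _ _ _ _)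

end CechBordismGroup

variable (K n A) in
/-- The canonical homomorphism `j` from bordism to Čech bordism, whose component at `U` is induced
by the inclusion `(X, A) → (X, U)`. -/
def toCech : BordismGroup K n A →+ CechBordismGroup K n A where
  toFun x := ⟨fun U => incl U.2.2 x, fun _ _ _ => BordismGroup.map_map _ _ _ _ _⟩
  map_zero' := Subtype.ext (funext fun _ => map_zero _)
  map_add' _ _ := Subtype.ext (funext fun _ => map_add _ _ _)

/-! ### Euclidean neighbourhood retracts -/

/-- `X` is a Euclidean neighbourhood retract: it is homeomorphic to a subspace `Y` of some `ℝᵐ`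
which is a retract of a neighbourhood `U` of `Y` in `ℝᵐ`. -/
def IsENR (X : Type u) [TopologicalSpace X] : Prop :=
  ∃ (m : ℕ) (Y : Set (EuclideanSpace ℝ (Fin m))), Nonempty (X ≃ₜ Y) ∧
    ∃ U ∈ 𝓝ˢ Y, ∃ r : EuclideanSpace ℝ (Fin m) → EuclideanSpace ℝ (Fin m),
      ContinuousOn r U ∧ MapsTo r U Y ∧ ∀ y ∈ Y, r y = y

end RelBordism

end

open Set Topology
open scoped Manifold ContDiff

noncomputable section

namespace RelBordism

universe u v

/-! Since `X` and `A` are ENRs, some open neighbourhood `V` of `A` can be deformed within `X` into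
`A`, keeping `A` fixed (`IsENR.nonempty_nhdDeformation`): join a point to its image under a
neighbourhood retraction onto `A` by a segment in the ambient Euclidean space of `X`, and project
the segment back to `X`. Call the deformation `h_t`.

Given `(M, f)` in `(X, V)`, choose a continuous `c : M → [0, 1]` with `c = 1` on `∂M` and support in
`f⁻¹(V)`. Then `x ↦ h_{c(x)}(f(x))` is continuous and sends `∂M` into `A`. Its class does not depend
on `c` (`bordant_push_push`), and the same trick applied to a bordism shows that it depends only on
the class of `(M, f)` (`bordant_push_of_bordant`). This defines a map `ρ` (`NhdDeformation.retract`)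
from the bordism of `(X, V)` to that of `(X, A)`.

Two facts then suffice. As `h_t` fixes `A`, `ρ` undoes the inclusion `(X, A) → (X, V)`, so `j` is
injective (`retract_incl`). For each open `U ⊇ A` there is a smaller neighbourhood `V_U ⊆ U ∩ V` of
`A` whose points stay in `U` throughout the deformation, so on classes coming from `(X, V_U)`
applying `ρ` and then including into `(X, U)` is just the inclusion (`incl_retract`). Hence
`j(ρ(x_V)) = x` for every compatible family `x`.

Only the maps to `X` are altered; apart from cylinders no new manifolds are built, and orientations
are carried along, so both kinds of bordism are treated together. -/

/-! ### Neighbourhood deformations of Euclidean neighbourhood retracts -/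

/-- A Euclidean neighbourhood retract is a retract of an open subset of some `ℝᵐ`. -/
lemma IsENR.exists_leftInverse {X : Type u} [TopologicalSpace X] (hX : IsENR X) :
    ∃ (m : ℕ) (O : Set (EuclideanSpace ℝ (Fin m))) (i : C(X, O)) (r : C(O, X)),
      IsOpen O ∧ Function.LeftInverse r i := by
  obtain ⟨m, Y, ⟨e⟩, U, hU, r, hr, hrY, hid⟩ := hX
  have hYU : Y ⊆ interior U := subset_interior_iff_mem_nhdsSet.2 hU
  refine ⟨m, interior U, ⟨fun x => ⟨e x, hYU (e x).2⟩, by fun_prop⟩,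
    ⟨fun p => e.symm ⟨r p, hrY (interior_subset p.2)⟩, ?_⟩, isOpen_interior, fun x => ?_⟩
  · exact e.symm.continuous.comp
      ((continuousOn_iff_continuous_domRestrict.1 (hr.mono interior_subset)).subtype_mk _)
  · change e.symm ⟨r (e x), _⟩ = x
    rw [e.symm_apply_eq]
    exact Subtype.ext (hid _ (e x).2)

lemma IsENR.locallyCompactSpace {X : Type u} [TopologicalSpace X] (hX : IsENR X) :
    LocallyCompactSpace X := by
  obtain ⟨m, O, i, r, hO, hri⟩ := hX.exists_leftInverse
  have : LocallyCompactSpace O := hO.locallyCompactSpace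
  exact (hri.isClosedEmbedding r.continuous i.continuous).locallyCompactSpace

lemma IsENR.metrizableSpace {X : Type u} [TopologicalSpace X] (hX : IsENR X) :
    TopologicalSpace.MetrizableSpace X := by
  obtain ⟨m, O, i, r, -, hri⟩ := hX.exists_leftInverse
  exact (hri.isEmbedding r.continuous i.continuous).metrizableSpace

/-- A locally compact subspace of a Hausdorff space is closed in an open neighbourhood. -/
lemma exists_isOpen_isClosed_preimage {X : Type u} [TopologicalSpace X] [T2Space X] (A : Set X)
    [LocallyCompactSpace A] :
    ∃ O : Set X, IsOpen O ∧ A ⊆ O ∧ IsClosed ((↑) ⁻¹' A : Set O) := by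
  have key : ∀ a : A, ∃ W : Set X, IsOpen W ∧ (a : X) ∈ W ∧ closure (W ∩ A) ⊆ A := by
    intro a
    obtain ⟨K, hK, hKa⟩ := exists_compact_mem_nhds a
    obtain ⟨W, hW, hWK⟩ := mem_nhds_induced _ _ _ |>.1 hKa
    refine ⟨interior W, isOpen_interior, mem_interior_iff_mem_nhds.2 hW, ?_⟩
    have hKc : IsCompact ((↑) '' K : Set X) := hK.image continuous_subtype_val
    -- `K` is compact, hence closed in the Hausdorff space `X`, so the closure of `W ∩ A` does not
    -- leave `K`.
    refine (closure_minimal ?_ hKc.isClosed).trans (Subtype.coe_image_subset A K)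
    rintro x ⟨hx, hxA⟩
    exact ⟨⟨x, hxA⟩, hWK (interior_subset (s := W) hx), rfl⟩
  choose W hW haW hWA using key
  refine ⟨⋃ a, W a, isOpen_iUnion hW, fun a ha => mem_iUnion.2 ⟨⟨a, ha⟩, haW _⟩, ?_⟩
  refine isClosed_of_closure_subset fun x hx => ?_
  obtain ⟨a, ha⟩ := mem_iUnion.1 x.2
  have hxA : (x : X) ∈ closure A :=
    closure_mono (image_preimage_subset _ _)
      (image_closure_subset_closure_image continuous_subtype_val (mem_image_of_mem _ hx))
  -- Because `W a` is open, a point of `W a` in the closure of `A` is in the closure of `W a ∩ A`.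
  exact hWA a ((hW a).inter_closure ⟨ha, hxA⟩)

/-- Every subspace `A` of a metrizable space which is a Euclidean neighbourhood retract is a retract
of an open neighbourhood. -/
lemma IsENR.exists_retraction {X : Type u} [TopologicalSpace X]
    [TopologicalSpace.MetrizableSpace X] {A : Set X} (hA : IsENR A) :
    ∃ (V : Set X) (r : C(V, A)), IsOpen V ∧ ∀ a : A, ∃ h : (a : X) ∈ V, r ⟨a, h⟩ = a := by
  have := hA.locallyCompactSpace
  obtain ⟨O, hO, hAO, hcl⟩ := exists_isOpen_isClosed_preimage A
  obtain ⟨m, Q, i, r, hQ, hri⟩ := hA.exists_leftInverse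
  let f : C(((↑) ⁻¹' A : Set O), EuclideanSpace ℝ (Fin m)) :=
    ⟨fun x => i ⟨x.1, x.2⟩, by fun_prop⟩
  -- Tietze's theorem on the metrizable, hence normal, space `O`, in which `A` is closed. The
  -- retraction is then `r ∘ g` on `g⁻¹(Q)`.
  obtain ⟨g, hg⟩ := f.exists_restrict_eq hcl
  have hgA : ∀ a : A, g ⟨a, hAO a.2⟩ = i a := fun a =>
    DFunLike.congr_fun hg ⟨⟨a, hAO a.2⟩, a.2⟩
  have hmem : ∀ x : ((↑) '' (g ⁻¹' Q) : Set X), ∃ h : (x : X) ∈ O, g ⟨x, h⟩ ∈ Q := by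
    rintro ⟨_, x, hx, rfl⟩
    exact ⟨x.2, hx⟩
  refine ⟨(↑) '' (g ⁻¹' Q), ⟨fun x => r ⟨g ⟨x, (hmem x).1⟩, (hmem x).2⟩, by fun_prop⟩,
    hO.isOpenMap_subtype_val _ (hQ.preimage g.continuous), fun a => ?_⟩
  have ha : g ⟨a, hAO a.2⟩ ∈ Q := by
    rw [hgA]
    exact (i a).2
  refine ⟨⟨_, ha, rfl⟩, ?_⟩
  refine Eq.trans (congrArg r (Subtype.ext ?_)) (hri a)
  exact hgA a

/-! ### Deforming a neighbourhood of `A` into `A` -/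

/-- A deformation in `X`, fixing `A`, of an open neighbourhood of `A` into `A`. Outside of the
neighbourhood the maps are arbitrary, except for that at time `0`. -/
structure NhdDeformation {X : Type u} [TopologicalSpace X] (A : Set X) where
  nhd : OpenNhd A
  toFun : X → ℝ → X
  continuousOn : ContinuousOn (Function.uncurry toFun) (nhd.1 ×ˢ univ)
  apply_zero : ∀ x, toFun x 0 = x
  apply_one : ∀ x ∈ nhd.1, toFun x 1 ∈ A
  apply_of_mem : ∀ x ∈ A, ∀ t, toFun x t = x

/-- With `r` a retraction of an open `V` onto `A` and `ρ ∘ i = id` for an open `O` of some `ℝᵐ`, the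
deformation is `ρ` applied to the segment from `i x` to `i (r x)`, for those `x` whose segment stays
in `O`. By compactness of `[0, 1]` these form an open set; it contains `A`, where the segments are
constant. -/
lemma IsENR.nonempty_nhdDeformation {X : Type u} [TopologicalSpace X] {A : Set X} (hX : IsENR X)
    (hA : IsENR A) : Nonempty (NhdDeformation A) := by
  classical
  have := hX.metrizableSpace
  obtain ⟨V, r, hV, hr⟩ := hA.exists_retraction
  obtain ⟨m, O, i, ρ, hO, hρ⟩ := hX.exists_leftInverse
  -- Clamping the time to `[0, 1]` makes `s` defined for all real times without leaving the segment.
  let s : V × ℝ → EuclideanSpace ℝ (Fin m) := fun p =>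
    AffineMap.lineMap (i p.1 : EuclideanSpace ℝ (Fin m)) (i (r p.1)) (projIcc 0 1 zero_le_one p.2 : ℝ)
  have hs : Continuous s := by
    simp only [s, AffineMap.lineMap_apply_module]
    fun_prop
  have hs0 : ∀ x, s (x, 0) = i x := by simp [s]
  have hs1 : ∀ x, s (x, 1) = i (r x) := by simp [s]
  have hsA : ∀ x t (h : x ∈ V), x ∈ A → s (⟨x, h⟩, t) = i x := by
    intro x t h hx
    obtain ⟨h1, h2⟩ := hr ⟨x, hx⟩
    simp [s, h2]
  let N : Set V := {x | ∀ t ∈ Icc (0 : ℝ) 1, s (x, t) ∈ O}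
  have hN : IsOpen N := by
    rw [isOpen_iff_mem_nhds]
    intro x hx
    exact isCompact_Icc.eventually_forall_of_forall_eventually fun t ht =>
      hs.continuousAt.eventually_mem (hO.mem_nhds (hx t ht))
  have hNmem : ∀ x : N, ∀ t, s (x, t) ∈ O := by
    intro x t
    have := x.2 _ (projIcc (0 : ℝ) 1 zero_le_one t).2
    simpa [s] using this
  have hmem : ∀ x : X, x ∈ ((↑) '' N : Set X) → ∃ h : x ∈ V, (⟨x, h⟩ : V) ∈ N := by
    rintro _ ⟨x, hx, rfl⟩
    exact ⟨x.2, hx⟩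
  have hsub : A ⊆ ((↑) '' N : Set X) := by
    intro a ha
    obtain ⟨h, -⟩ := hr ⟨a, ha⟩
    refine ⟨⟨a, h⟩, fun t _ => ?_, rfl⟩
    rw [hsA a t h ha]
    exact (i a).2
  -- The default value `x` off the neighbourhood makes time `0` the identity on all of `X`, which
  -- the later patching by cutoffs relies on.
  refine ⟨⟨⟨(↑) '' N, hV.isOpenMap_subtype_val _ hN, hsub⟩, fun x t =>
    if h : x ∈ ((↑) '' N : Set X) then
      ρ ⟨s (⟨x, (hmem x h).1⟩, t), hNmem ⟨_, (hmem x h).2⟩ t⟩ else x, ?_, ?_, ?_, ?_⟩⟩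
  · rw [continuousOn_iff_continuous_domRestrict]
    have : Continuous fun p : ((↑) '' N : Set X) ×ˢ (univ : Set ℝ) =>
        ρ ⟨s (⟨p.1.1, (hmem p.1.1 p.2.1).1⟩, p.1.2), hNmem ⟨_, (hmem p.1.1 p.2.1).2⟩ p.1.2⟩ := by
      fun_prop
    convert this using 2 with p
    exact dif_pos p.2.1
  · intro x
    split_ifs with h
    · exact (congrArg ρ (Subtype.ext (hs0 _))).trans (hρ x)
    · rfl
  · intro x hx
    rw [dif_pos hx]
    have h : ρ ⟨s (⟨x, (hmem x hx).1⟩, 1), hNmem ⟨_, (hmem x hx).2⟩ 1⟩ =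
        r ⟨x, (hmem x hx).1⟩ := (congrArg ρ (Subtype.ext (hs1 _))).trans (hρ _)
    exact h ▸ (r _).2
  · intro x hx t
    rw [dif_pos (hsub hx)]
    exact (congrArg ρ (Subtype.ext (hsA x t _ hx))).trans (hρ x)

namespace NhdDeformation

variable {X : Type u} [TopologicalSpace X] {A : Set X} (D : NhdDeformation A)

/-- Near `A`, the deformation stays in any given neighbourhood `U` of `A`. -/
def shrink (U : OpenNhd A) : OpenNhd A :=
  ⟨{x | x ∈ D.nhd.1 ∧ ∀ t ∈ Icc (0 : ℝ) 1, D.toFun x t ∈ U.1}, by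
    rw [isOpen_iff_mem_nhds]
    rintro x ⟨hx, h⟩
    refine Filter.inter_mem (D.nhd.2.1.mem_nhds hx)
      (isCompact_Icc.eventually_forall_of_forall_eventually fun t ht => ?_)
    -- Since time runs through all of `ℝ`, the domain of continuity is open, so there is honest
    -- joint continuity also at times `0` and `1`.
    exact (D.continuousOn.continuousAt ((D.nhd.2.1.prod isOpen_univ).mem_nhds
      ⟨hx, trivial⟩)).eventually_mem (U.2.1.mem_nhds (h t ht)), fun a ha =>
    ⟨D.nhd.2.2 ha, fun t _ => by rw [D.apply_of_mem a ha]; exact U.2.2 ha⟩⟩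

lemma shrink_subset_nhd (U : OpenNhd A) : (D.shrink U).1 ⊆ D.nhd.1 := fun _ hx => hx.1

lemma shrink_subset (U : OpenNhd A) : (D.shrink U).1 ⊆ U.1 := fun x hx => by
  simpa [D.apply_zero] using hx.2 0 (by simp)

/-! ### Cutoff functions -/

/-- A function by which points of a singular space `f : T → X` can be moved along the
deformation, and which moves the points of `S` into `A`. -/
structure IsCutoff {T : Type v} [TopologicalSpace T] (f : T → X) (S : Set T) (c : T → ℝ) :
    Prop where
  continuous : Continuous c
  mem_Icc : ∀ x, c x ∈ Icc (0 : ℝ) 1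
  eq_one : ∀ x ∈ S, c x = 1
  tsupport_subset : tsupport c ⊆ f ⁻¹' D.nhd.1

variable {D} {T : Type v} [TopologicalSpace T] {f : T → X} {S : Set T} {c : T → ℝ}

/-- Urysohn's lemma in the compact Hausdorff space `T`, for the closed set `S` inside the open set
`f⁻¹(D.nhd)`. -/
lemma exists_isCutoff [CompactSpace T] [T2Space T] (hf : Continuous f) (hS : IsClosed S)
    (h : MapsTo f S D.nhd.1) : ∃ c, D.IsCutoff f S c := by
  obtain ⟨c, h2, h1, h3⟩ := exists_tsupport_one_of_isOpen_isClosed (D.nhd.2.1.preimage hf)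
    isClosed_closure.isCompact hS h
  exact ⟨c, c.continuous, h3, h1, h2⟩

/-- On `Z` the deformation is jointly continuous, and on the open complement of `Z` the time is `0`,
so the map is just `f`. A general closed `Z` is allowed because homotopies between two cutoffs need
the union of both supports. -/
lemma continuous_toFun (hf : Continuous f) (hc : Continuous c)
    {Z : Set T} (hZ : IsClosed Z) (hZf : Z ⊆ f ⁻¹' D.nhd.1) (h0 : ∀ x ∉ Z, c x = 0) :
    Continuous fun x => D.toFun (f x) (c x) := by
  rw [continuous_iff_continuousAt]
  intro x
  by_cases hx : x ∈ Z
  · have h := D.continuousOn.continuousAt (x := (f x, c x))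
      ((D.nhd.2.1.prod isOpen_univ).mem_nhds ⟨hZf hx, trivial⟩)
    exact h.comp₂ hf.continuousAt hc.continuousAt
  · refine hf.continuousAt.congr ?_
    filter_upwards [hZ.isOpen_compl.mem_nhds hx] with y hy
    rw [h0 y hy, D.apply_zero]

lemma IsCutoff.continuous_toFun (hc : D.IsCutoff f S c) (hf : Continuous f) :
    Continuous fun x => D.toFun (f x) (c x) :=
  NhdDeformation.continuous_toFun hf hc.continuous (isClosed_tsupport c) hc.tsupport_subset
    fun _ hx => image_eq_zero_of_notMem_tsupport hx

lemma IsCutoff.mapsTo_toFun (hc : D.IsCutoff f S c) :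
    MapsTo (fun x => D.toFun (f x) (c x)) S A := by
  intro x hx
  have h1 := hc.eq_one x hx
  have : f x ∈ D.nhd.1 := hc.tsupport_subset (subset_tsupport c (by simp [h1]))
  beta_reduce
  rw [h1]
  exact D.apply_one _ this

/-- Used to restrict a cutoff on a bordism to its two ends. -/
lemma IsCutoff.comp {T' : Type v} [TopologicalSpace T'] (hc : D.IsCutoff f S c) {g : T' → T}
    (hg : Continuous g) {f' : T' → X} (hf : ∀ x, f (g x) = f' x) {S' : Set T'}
    (hS : MapsTo g S' S) : D.IsCutoff f' S' (c ∘ g) where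
  continuous := hc.continuous.comp hg
  mem_Icc x := hc.mem_Icc _
  eq_one x hx := hc.eq_one _ (hS hx)
  tsupport_subset x hx := by
    have := hc.tsupport_subset (tsupport_comp_subset_preimage c hg hx)
    simpa only [mem_preimage, hf] using this

end NhdDeformation

/-! ### Deforming singular manifolds -/

variable {K : Kind} {n : ℕ} {X : Type u} [TopologicalSpace X] {A B : Set X}

/-- Homotopic maps of pairs on the same manifold are bordant. -/
lemma Bordant.of_homotopy (P : RelSingularManifold K n B) {f₀ f₁ : P.M → X}
    (hf₀ : Continuous f₀) (hf₁ : Continuous f₁)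
    (hA₀ : MapsTo f₀ ((bdryModel n).boundary P.M) A)
    (hA₁ : MapsTo f₁ ((bdryModel n).boundary P.M) A)
    (G : P.M × Icc (0 : ℝ) 1 → X) (hG : Continuous G) (h₀ : ∀ x, G (x, 0) = f₀ x)
    (h₁ : ∀ x, G (x, 1) = f₁ x)
    (hA : ∀ p : P.M × Icc (0 : ℝ) 1, p.1 ∈ (bdryModel n).boundary P.M → G p ∈ A) :
    Bordant (P.withMap f₀ hf₀ hA₀) (P.withMap f₁ hf₁ hA₁) := by
  -- The ends of `NullBordism.cylinder` are literally the restrictions of `G`, so the given end maps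
  -- are replaced by them.
  obtain rfl : (fun x => G (x, 0)) = f₀ := funext h₀
  obtain rfl : (fun x => G (x, 1)) = f₁ := funext h₁
  exact ⟨NullBordism.cylinder (P.withMap (fun x => G (x, 0)) hf₀ hA₀) G hG hA⟩

lemma isClosed_boundary (P : RelSingularManifold K n A) :
    IsClosed ((bdryModel n).boundary P.M) :=
  (bdryModel n).isClosed_boundary (n := ∞) (by simp)

namespace NhdDeformation

variable {D : NhdDeformation A}

/-- The singular manifold in `(X, A)` obtained by moving the boundary of a singular manifold into
`A`. -/
def push (P : RelSingularManifold K n B) {c : P.M → ℝ}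
    (hc : D.IsCutoff P.f ((bdryModel n).boundary P.M) c) : RelSingularManifold K n A :=
  P.withMap (fun x => D.toFun (P.f x) (c x)) (hc.continuous_toFun P.continuous_f) hc.mapsTo_toFun

lemma exists_isCutoff_boundary (P : RelSingularManifold K n D.nhd.1) :
    ∃ c, D.IsCutoff P.f ((bdryModel n).boundary P.M) c :=
  exists_isCutoff P.continuous_f (isClosed_boundary P) P.mapsTo_boundary

/-- The deformation times are interpolated linearly from `c'` to `c''`. It is applied with `c'` a
second cutoff, to compare two pushes, and with `c' = 0`, to compare a push with the original map. -/
lemma continuous_homotopy (P : RelSingularManifold K n B) {c c' : P.M → ℝ}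
    (hc : D.IsCutoff P.f ((bdryModel n).boundary P.M) c) (hc' : Continuous c')
    (h0 : ∀ x ∉ tsupport c, c' x = 0) {c'' : P.M → ℝ} {S : Set P.M}
    (hc'' : D.IsCutoff P.f S c'') :
    Continuous fun p : P.M × Icc (0 : ℝ) 1 =>
      D.toFun (P.f p.1) ((1 - p.2.1) * c' p.1 + p.2.1 * c'' p.1) := by
  have := hc''.continuous
  have := P.continuous_f
  refine continuous_toFun (by fun_prop) (by fun_prop)
    (((isClosed_tsupport c).union (isClosed_tsupport c'')).preimage continuous_fst) ?_ ?_
  · rintro ⟨x, t⟩ (hx | hx)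
    · exact hc.tsupport_subset hx
    · exact hc''.tsupport_subset hx
  · rintro ⟨x, t⟩ hx
    have hx' : ¬ (x ∈ tsupport c ∨ x ∈ tsupport c'') := hx
    rw [not_or] at hx'
    simp only
    rw [h0 x hx'.1, image_eq_zero_of_notMem_tsupport hx'.2]
    simp

/-- Both cutoffs equal `1` on the boundary, so every interpolated time is `1` there and the boundary
stays in `A` throughout the homotopy. -/
lemma bordant_push_push (P : RelSingularManifold K n B) {c c' : P.M → ℝ}
    (hc : D.IsCutoff P.f ((bdryModel n).boundary P.M) c)
    (hc' : D.IsCutoff P.f ((bdryModel n).boundary P.M) c') : Bordant (push P hc) (push P hc') := by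
  refine Bordant.of_homotopy P _ _ _ _ _ (continuous_homotopy P hc hc.continuous
    (fun _ => image_eq_zero_of_notMem_tsupport) hc') (by simp) (by simp) ?_
  rintro ⟨x, t⟩ hx
  have h : P.f x ∈ D.nhd.1 :=
    hc.tsupport_subset (subset_tsupport c (by simp [hc.eq_one x hx]))
  simpa [hc.eq_one x hx, hc'.eq_one x hx] using D.apply_one _ h

/-- If the deformation keeps the boundary in `U`, then pushing does not change the bordism class
in `(X, U)`. -/
lemma bordant_push {U : Set X} (P : RelSingularManifold K n B) {c : P.M → ℝ}
    (hc : D.IsCutoff P.f ((bdryModel n).boundary P.M) c) (hAU : A ⊆ U) (hBU : B ⊆ U)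
    (h : ∀ x ∈ B, ∀ t ∈ Icc (0 : ℝ) 1, D.toFun x t ∈ U) :
    Bordant (P.map (.id X) hBU) ((push P hc).map (.id X) hAU) := by
  -- With `c' = 0` the homotopy starts at `P.f`, and on the boundary, where `c = 1`, its deformation
  -- time is the homotopy parameter itself; this is where `h` enters.
  refine Bordant.of_homotopy P _ _ _ _ _ (continuous_homotopy P hc (c' := 0) continuous_zero
    (fun _ _ => rfl) hc) (by simp [D.apply_zero]) (by simp [push, RelSingularManifold.withMap]) ?_
  rintro ⟨x, t⟩ hx
  simpa [hc.eq_one x hx] using h _ (P.mapsTo_boundary hx) t t.2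

/-- Push the whole bordism by a cutoff `d` equal to `1` on its side. This joins the pushes of `P`
and `Q` by the restrictions of `d`, which need not be `c` and `c'`; hence the two outer bordisms. A
chain is enough, as it becomes an equality in the quotient without any gluing. -/
lemma bordant_push_of_bordant {P Q : RelSingularManifold K n D.nhd.1} (h : Bordant P Q)
    {c : P.M → ℝ} (hc : D.IsCutoff P.f ((bdryModel n).boundary P.M) c)
    {c' : Q.M → ℝ} (hc' : D.IsCutoff Q.f ((bdryModel n).boundary Q.M) c') :
    ∃ P' Q' : RelSingularManifold K n A, Bordant (push P hc) P' ∧ Bordant P' Q' ∧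
      Bordant Q' (push Q hc') := by
  obtain ⟨V⟩ := h
  obtain ⟨d, hd⟩ := exists_isCutoff (D := D) V.continuous_F V.isClosed_side V.F_side
  -- The boundaries of both ends lie in the side, where `d = 1`; this makes the restrictions of `d`
  -- cutoffs for `P` and `Q`.
  have hside : MapsTo V.φ ((bdryModel n).boundary (P.sum Q.neg).M) V.side := fun x hx =>
    (V.inter_eq.symm.subset (mem_image_of_mem _ hx)).2
  rw [sum_boundary] at hside
  have hφ : Continuous V.φ := V.smooth_φ.continuous
  have hP : D.IsCutoff P.f ((bdryModel n).boundary P.M) (d ∘ V.φ ∘ Sum.inl) :=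
    hd.comp (hφ.comp continuous_inl) (fun x => V.F_φ (Sum.inl x)) fun x hx =>
      hside (Or.inl (mem_image_of_mem _ hx))
  have hQ : D.IsCutoff Q.f ((bdryModel n).boundary Q.M) (d ∘ V.φ ∘ Sum.inr) :=
    hd.comp (hφ.comp continuous_inr) (fun x => V.F_φ (Sum.inr x)) fun x hx =>
      hside (Or.inr (mem_image_of_mem _ hx))
  refine ⟨push P hP, push Q hQ, bordant_push_push P hc hP, ⟨{
    W := V.W
    orientation := V.orientation
    F := fun x => D.toFun (V.F x) (d x)
    continuous_F := hd.continuous_toFun V.continuous_F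
    φ := V.φ
    smooth_φ := V.smooth_φ
    injective_φ := V.injective_φ
    immersion_φ := V.immersion_φ
    side := V.side
    isClosed_side := V.isClosed_side
    boundary_eq := V.boundary_eq
    inter_eq := V.inter_eq
    cornerPoints_subset := V.cornerPoints_subset
    F_φ := by
      rintro (x | x)
      · exact congrArg (D.toFun · _) (V.F_φ (Sum.inl x))
      · exact congrArg (D.toFun · _) (V.F_φ (Sum.inr x))
    F_side := hd.mapsTo_toFun
    orientation_φ := V.orientation_φ }⟩, bordant_push_push Q hQ hc'⟩

lemma mk_push_eq_of_bordant {P Q : RelSingularManifold K n D.nhd.1} (h : Bordant P Q)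
    {c : P.M → ℝ} (hc : D.IsCutoff P.f ((bdryModel n).boundary P.M) c)
    {c' : Q.M → ℝ} (hc' : D.IsCutoff Q.f ((bdryModel n).boundary Q.M) c') :
    BordismGroup.mk (push P hc) = BordismGroup.mk (push Q hc') := by
  obtain ⟨P', Q', h1, h2, h3⟩ := bordant_push_of_bordant h hc hc'
  exact (Quot.sound h1).trans ((Quot.sound h2).trans (Quot.sound h3))

/-! ### The inverse of the canonical homomorphism -/

variable (D) in
/-- The map `Ωₙ(X, V) → Ωₙ(X, A)` given by a deformation of the neighbourhood `V` into `A`. -/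
def retract : BordismGroup K n D.nhd.1 → BordismGroup K n A :=
  Quot.lift (fun P => BordismGroup.mk (push P (exists_isCutoff_boundary P).choose_spec))
    fun _ _ h => mk_push_eq_of_bordant h _ _

/-- Frees `retract` from its arbitrary choice of cutoff. -/
lemma retract_mk (P : RelSingularManifold K n D.nhd.1) {c : P.M → ℝ}
    (hc : D.IsCutoff P.f ((bdryModel n).boundary P.M) c) :
    D.retract (BordismGroup.mk P) = BordismGroup.mk (push P hc) :=
  Quot.sound (bordant_push_push P _ hc)

/-- If the boundary already lies in `A`, the deformation does not move it, so pushing is a homotopy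
of maps of pairs into `(X, A)`: `bordant_push` with both subspaces and `U` equal to `A`. -/
lemma retract_incl (x : BordismGroup K n A) : D.retract (incl D.nhd.2.2 x) = x := by
  obtain ⟨P⟩ := x
  obtain ⟨c, hc⟩ := exists_isCutoff_boundary (D := D) (P.map (.id X) D.nhd.2.2)
  refine (retract_mk _ hc).trans (Quot.sound ?_).symm
  exact bordant_push P hc subset_rfl subset_rfl fun x hx t _ => by rwa [D.apply_of_mem x hx]

/-- For a boundary in `D.nhd` the deformation could leave `U` on its way to `A`; starting in
`D.shrink U` it cannot, so pushing is a homotopy of maps of pairs into `(X, U)`. -/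
lemma incl_retract (U : OpenNhd A) (x : BordismGroup K n (D.shrink U).1) :
    incl U.2.2 (D.retract (incl (D.shrink_subset_nhd U) x)) = incl (D.shrink_subset U) x := by
  obtain ⟨P⟩ := x
  obtain ⟨c, hc⟩ := exists_isCutoff_boundary (D := D) (P.map (.id X) (D.shrink_subset_nhd U))
  refine (congrArg (incl U.2.2) (retract_mk _ hc)).trans (Quot.sound ?_).symm
  exact bordant_push P hc U.2.2 (D.shrink_subset U) fun x hx => hx.2

lemma bijective_toCech (D : NhdDeformation A) : Function.Bijective (toCech K n A) := by
  constructor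
  · intro x y h
    have h1 : incl D.nhd.2.2 x = incl D.nhd.2.2 y := congrFun (congrArg Subtype.val h) D.nhd
    -- The single component at `D.nhd` already determines the class.
    rw [← D.retract_incl x, h1, D.retract_incl]
  · intro x
    refine ⟨D.retract (x.1 D.nhd), Subtype.ext (funext fun U => ?_)⟩
    change incl U.2.2 (D.retract (x.1 D.nhd)) = x.1 U
    -- Compatibility is used twice: the component at `D.nhd` comes from the one at `D.shrink U`,
    -- where `incl_retract` applies, and the latter also maps to the component at `U`.
    rw [← x.2 (D.shrink U) D.nhd (D.shrink_subset_nhd U), incl_retract,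
      x.2 (D.shrink U) U (D.shrink_subset U)]

end NhdDeformation

end RelBordism

end

theorem mainTheorem4 (K : RelBordism.Kind) (n : ℕ) (X : Type*) [TopologicalSpace X] (A : Set X) :
    (∀ (P : RelBordism.RelSingularManifold K n A) (U : RelBordism.OpenNhd A),
      (RelBordism.toCech K n A (RelBordism.BordismGroup.mk P)).1 U =
        RelBordism.BordismGroup.mk (P.map (ContinuousMap.id X) U.2.2)) ∧
    (RelBordism.IsENR X → RelBordism.IsENR A →
      Function.Bijective (RelBordism.toCech K n A :
        RelBordism.BordismGroup K n A →+ RelBordism.CechBordismGroup K n A)) ∧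
    (∀ (Y : Type*) [TopologicalSpace Y] (B : Set Y) (g : C(X, Y)) (hg : Set.MapsTo g A B)
      (x : RelBordism.BordismGroup K n A),
      RelBordism.toCech K n B (RelBordism.BordismGroup.map g hg x) =
        RelBordism.CechBordismGroup.map g hg (RelBordism.toCech K n A x)) := by

  refine ⟨fun _ _ => rfl, fun hX hA => ?_, fun Y _ B g hg x => ?_⟩
  · obtain ⟨D⟩ := hX.nonempty_nhdDeformation hA
    exact D.bijective_toCech
  · refine Subtype.ext (funext fun V => ?_)
    -- On a representative `(M, f)` both sides have the component at `V` given by `(M, g ∘ f)`.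
    obtain ⟨P⟩ := x
    rfl
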